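/- Theorem 4.3. Let $M$ be a smooth $n$-dimensional manifold and let $G$ be a spray on $M$, i.e. a vector field on $TM$ which in all induced local coordinates $(x^i,y^i)$ has the form $$G=y^i\frac{\partial}{\partial x^i}-2G^i(x,y)\frac{\partial}{\partial y^i},$$ where each $G^i$ is $C^\infty$ at $y\neq 0$ and $G^i(x,\lambda y)=\lambda^2G^i(x,y)$ for all $\lambda>0$. Put $N^i_j=\frac{\partial G^i}{\partial y^j}$, $\Gamma^i_{jk}=\frac{\partial^2 G^i}{\partial y^j\partial y^k}$, $\frac{\delta}{\delta x^k}=\frac{\partial}{\partial x^k}-N^s_k\frac{\partial}{\partial y^s}$, $$R_{j\ kl}^{\ i}=\frac{\delta\Gamma^i_{jl}}{\delta x^k}-\frac{\delta\Gamma^i_{jk}}{\delta x^l}+\Gamma^i_{ks}\Gamma^s_{jl}-\Gamma^s_{jk}\Gamma^i_{ls},\qquad R^i_{\ k}=y^jR_{j\ kl}^{\ i}y^l,$$ and let $$\chi_k=-\frac16\Big\{2\frac{\partial R^m_{\ k}}{\partial y^m}+\frac{\partial R^m_{\ m}}{\partial y^k}\Big\}$$ be the $\chi$-curvature of $G$.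 Let $dV=\sigma(x)\,dx^1\cdots dx^n$ ($\sigma>0$) be a smooth volume form (positive density) on $M$, and let $$S=\frac{\partial G^m}{\partial y^m}-y^m\frac{\partial \ln\sigma}{\partial x^m}$$ be the S-curvature of $(G,dV)$, a function on $TM$. Suppose that $\chi=0$ at all nonzero tangent vectors and that $\tilde F=|S|$ is a Finsler metric on $M$, i.e. $\tilde F\ge 0$ with $\tilde F=0$ exactly at zero vectors, $\tilde F$ is $C^\infty$ on $TM\setminus\{0\}$ and positively homogeneous of degree one, and $\tilde g_{ij}=\frac12\frac{\partial^2\tilde F^2}{\partial y^i\partial y^j}$ is positive definite for $y\neq0$. Then $\tilde F$ is projectively equivalent to $G$: there is a $C^\infty$ function $P$ on $TM\setminus\{0\}$, with $P(\lambda v)=\lambda P(v)$ for all $\lambda>0$, such that in all induced local coordinates the spray coefficients $$\tilde G^i=\frac14\tilde g^{il}\Big\{\frac{\partial^2\tilde F^2}{\partial x^k\partial y^l}y^k-\frac{\partial\tilde F^2}{\partial x^l}\Big\}$$ of $\tilde F$ satisfy $\tilde G^i=G^i+P\,y^i$ for $y\ne0$. -/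

import Mathlib

open scoped Manifold ContDiff

noncomputable section

namespace SprayGeometry

/-! ### Calculus in a coordinate domain

A point of `ℝⁿ × ℝⁿ` is written `z = (x, y)`: position coordinates and fibre coordinates. -/

/-- The coordinate space `ℝⁿ`. -/
abbrev Coord (n : ℕ) := EuclideanSpace ℝ (Fin n)

/-- The partial derivative `∂f/∂xᵏ` of a function of `(x, y)`. -/
def dx {n : ℕ} (k : Fin n) (f : Coord n × Coord n → ℝ) (z : Coord n × Coord n) : ℝ :=
  fderiv ℝ f z (EuclideanSpace.single k 1, 0)

/-- The partial derivative `∂f/∂yᵏ` of a function of `(x, y)`. -/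
def dy {n : ℕ} (k : Fin n) (f : Coord n × Coord n → ℝ) (z : Coord n × Coord n) : ℝ :=
  fderiv ℝ f z (0, EuclideanSpace.single k 1)

/-- `Nⁱⱼ = ∂Gⁱ/∂yʲ`. -/
def connN {n : ℕ} (G : Fin n → Coord n × Coord n → ℝ) (i j : Fin n) :
    Coord n × Coord n → ℝ :=
  dy j (G i)

/-- `Γⁱⱼₖ = ∂²Gⁱ/∂yʲ∂yᵏ`, the coefficients of the Berwald connection. -/
def connGamma {n : ℕ} (G : Fin n → Coord n × Coord n → ℝ) (i j k : Fin n) :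
    Coord n × Coord n → ℝ :=
  dy j (dy k (G i))

/-- The horizontal derivative `δf/δxᵏ = ∂f/∂xᵏ - Nˢₖ ∂f/∂yˢ`. -/
def horiz {n : ℕ} (G : Fin n → Coord n × Coord n → ℝ) (k : Fin n)
    (f : Coord n × Coord n → ℝ) (z : Coord n × Coord n) : ℝ :=
  dx k f z - ∑ s, connN G s k z * dy s f z

/-- The Riemann curvature tensor `Rⱼⁱₖₗ` of the Berwald connection:
`δΓⁱⱼₗ/δxᵏ - δΓⁱⱼₖ/δxˡ + Γⁱₖₛ Γˢⱼₗ - Γˢⱼₖ Γⁱₗₛ`. -/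
def riemann4 {n : ℕ} (G : Fin n → Coord n × Coord n → ℝ) (j i k l : Fin n)
    (z : Coord n × Coord n) : ℝ :=
  horiz G k (connGamma G i j l) z - horiz G l (connGamma G i j k) z
    + ∑ s, (connGamma G i k s z * connGamma G s j l z
        - connGamma G s j k z * connGamma G i l s z)

/-- The two-index Riemann curvature `Rⁱₖ = yʲ Rⱼⁱₖₗ yˡ`. -/
def riemann2 {n : ℕ} (G : Fin n → Coord n × Coord n → ℝ) (i k : Fin n)
    (z : Coord n × Coord n) : ℝ :=
  ∑ j, ∑ l, z.2 j * riemann4 G j i k l z * z.2 l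

/-- The χ-curvature `χₖ = -(1/6) (2 ∂Rᵐₖ/∂yᵐ + ∂Rᵐₘ/∂yᵏ)`. -/
def chi {n : ℕ} (G : Fin n → Coord n × Coord n → ℝ) (k : Fin n)
    (z : Coord n × Coord n) : ℝ :=
  -(1 / 6) * ∑ m, (2 * dy m (riemann2 G m k) z + dy k (riemann2 G m m) z)

/-- The matrix `gᵢⱼ = (1/2) ∂²(F²)/∂yⁱ∂yʲ`, for `F` written in coordinates `(x, y)`. -/
def fundamentalTensor {n : ℕ} (F : Coord n × Coord n → ℝ) (z : Coord n × Coord n) :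
    Matrix (Fin n) (Fin n) ℝ :=
  Matrix.of fun i j => 1 / 2 * dy i (dy j (fun w => F w ^ 2)) z

/-- The spray coefficients of a Finsler metric `F` written in coordinates `(x, y)`:
`(1/4) gⁱˡ (∂²(F²)/∂xᵏ∂yˡ yᵏ - ∂(F²)/∂xˡ)`. -/
def finslerCoeff {n : ℕ} (F : Coord n × Coord n → ℝ) (i : Fin n)
    (z : Coord n × Coord n) : ℝ :=
  1 / 4 * ∑ l, (fundamentalTensor F z)⁻¹ i l *
    ((∑ k, dx k (dy l (fun w => F w ^ 2)) z * z.2 k) - dx l (fun w => F w ^ 2) z)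

/-! ### Objects on a manifold -/

section Manifold

variable {n : ℕ} {M : Type*} [TopologicalSpace M] [ChartedSpace (Coord n) M]

/-- The local coordinate systems of `M`: the charts of its maximal smooth atlas. -/
abbrev IsChart (e : OpenPartialHomeomorph M (Coord n)) : Prop :=
  e ∈ IsManifold.maximalAtlas (𝓡 n) ∞ M

/-- The coordinates `(x, y)` on `TM` induced by a chart `e` of `M`: a vector `yⁱ ∂/∂xⁱ` at `p`
is sent to `(e p, y)`. -/
def tangentCoord (e : OpenPartialHomeomorph M (Coord n)) (v : TangentBundle (𝓡 n) M) :
    Coord n × Coord n :=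
  (e v.proj, mfderiv (𝓡 n) (𝓡 n) e v.proj v.2)

/-- The tangent vector with coordinates `z = (x, y)` in the chart `e`, that is `yⁱ ∂/∂xⁱ` at
the point with coordinates `x`. -/
def ofCoord (e : OpenPartialHomeomorph M (Coord n)) (z : Coord n × Coord n) :
    TangentBundle (𝓡 n) M :=
  ⟨e.symm z.1, mfderiv (𝓡 n) (𝓡 n) e.symm z.1 z.2⟩

/-- The set of nonzero tangent vectors. -/
def slit (n : ℕ) (M : Type*) [TopologicalSpace M] [ChartedSpace (Coord n) M] :
    Set (TangentBundle (𝓡 n) M) :=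
  {v | v.2 ≠ 0}

/-- Positive homogeneity of degree one on nonzero tangent vectors. -/
def PosHomogeneous (f : TangentBundle (𝓡 n) M → ℝ) : Prop :=
  ∀ (p : M) (v : TangentSpace (𝓡 n) p), v ≠ 0 → ∀ c : ℝ, 0 < c →
    f ⟨p, c • v⟩ = c * f ⟨p, v⟩

/-- A volume form on `M`, understood as a smooth positive density: it is not assumed that `M` is
orientable, and a nowhere vanishing `n`-form `ω` is covered through `|ω|`.
`density p b` is the volume of the parallelepiped spanned by `b` in the tangent space at `p`; the
coefficient `σ` in `dV = σ dx¹ ⋯ dxⁿ` is its value on `∂/∂x¹, …, ∂/∂xⁿ`. -/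
structure VolumeForm (n : ℕ) (M : Type*) [TopologicalSpace M] [ChartedSpace (Coord n) M] where
  density : ∀ p : M, (Fin n → TangentSpace (𝓡 n) p) → ℝ
  map_det : ∀ (p : M) (A : TangentSpace (𝓡 n) p →ₗ[ℝ] TangentSpace (𝓡 n) p)
    (b : Fin n → TangentSpace (𝓡 n) p),
    density p (fun i => A (b i)) = |LinearMap.det A| * density p b
  pos : ∀ (p : M) (b : Fin n → TangentSpace (𝓡 n) p), LinearIndependent ℝ b → 0 < density p b
  smooth : ∀ e : OpenPartialHomeomorph M (Coord n), IsChart e →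
    ContDiffOn ℝ ∞
      (fun x => density (e.symm x)
        (fun i => mfderiv (𝓡 n) (𝓡 n) e.symm x (EuclideanSpace.single i (1 : ℝ)))) e.target

/-- The coefficient `σ` of `dV = σ dx¹ ⋯ dxⁿ` in the chart `e`. -/
def VolumeForm.coeff (dV : VolumeForm n M) (e : OpenPartialHomeomorph M (Coord n))
    (x : Coord n) : ℝ :=
  dV.density (e.symm x)
    (fun i => mfderiv (𝓡 n) (𝓡 n) e.symm x (EuclideanSpace.single i (1 : ℝ)))

variable [IsManifold (𝓡 n) ∞ M]

/-- The components of a vector field `X` on `TM` in the coordinates `(x, y)` induced by the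
chart `e`: the pair `(a, b)` stands for `aⁱ ∂/∂xⁱ + bⁱ ∂/∂yⁱ`. -/
def fieldCoord (X : ∀ v : TangentBundle (𝓡 n) M, TangentSpace (𝓡 n).tangent v)
    (e : OpenPartialHomeomorph M (Coord n)) (z : Coord n × Coord n) : Coord n × Coord n :=
  mfderiv (𝓡 n).tangent 𝓘(ℝ, Coord n × Coord n) (tangentCoord e) (ofCoord e z) (X (ofCoord e z))

/-- The functions `Gⁱ` in `X = yⁱ ∂/∂xⁱ - 2 Gⁱ ∂/∂yⁱ`. -/
def fieldCoeff (X : ∀ v : TangentBundle (𝓡 n) M, TangentSpace (𝓡 n).tangent v)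
    (e : OpenPartialHomeomorph M (Coord n)) (i : Fin n) (z : Coord n × Coord n) : ℝ :=
  -(1 / 2) * (fieldCoord X e z).2 i

/-- A spray on `M`: a vector field on `TM` which in all induced coordinates has the form
`yⁱ ∂/∂xⁱ - 2 Gⁱ ∂/∂yⁱ`, with `Gⁱ` smooth at nonzero vectors and positively homogeneous of degree
two in `y`. -/
structure Spray (n : ℕ) (M : Type*) [TopologicalSpace M] [ChartedSpace (Coord n) M]
    [IsManifold (𝓡 n) ∞ M] where
  field : ∀ v : TangentBundle (𝓡 n) M, TangentSpace (𝓡 n).tangent v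
  fst_eq : ∀ e : OpenPartialHomeomorph M (Coord n), IsChart e → ∀ x ∈ e.target, ∀ y : Coord n,
    (fieldCoord field e (x, y)).1 = y
  smooth : ∀ e : OpenPartialHomeomorph M (Coord n), IsChart e → ∀ i : Fin n,
    ContDiffOn ℝ ∞ (fieldCoeff field e i) (e.target ×ˢ {y : Coord n | y ≠ 0})
  homogeneous : ∀ e : OpenPartialHomeomorph M (Coord n), IsChart e → ∀ i : Fin n,
    ∀ x ∈ e.target, ∀ (y : Coord n) (c : ℝ), 0 < c →
      fieldCoeff field e i (x, c • y) = c ^ 2 * fieldCoeff field e i (x, y)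

/-- The spray coefficients `Gⁱ(x, y)` in the chart `e`. -/
def Spray.coeff (G : Spray n M) (e : OpenPartialHomeomorph M (Coord n)) (i : Fin n) :
    Coord n × Coord n → ℝ :=
  fieldCoeff G.field e i

/-- `χ = 0`: all components of the χ-curvature vanish, in all coordinate systems, at all nonzero
tangent vectors. -/
def Spray.ChiVanishes (G : Spray n M) : Prop :=
  ∀ e : OpenPartialHomeomorph M (Coord n), IsChart e → ∀ x ∈ e.target, ∀ y : Coord n, y ≠ 0 →
    ∀ k : Fin n, chi (G.coeff e) k (x, y) = 0

/-- The S-curvature of `(G, dV)` in the coordinates induced by `e`: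
`∂Gᵐ/∂yᵐ - yᵐ ∂(ln σ)/∂xᵐ`, where `dV = σ dx¹ ⋯ dxⁿ`. -/
def sCurvatureIn (G : Spray n M) (dV : VolumeForm n M)
    (e : OpenPartialHomeomorph M (Coord n)) (z : Coord n × Coord n) : ℝ :=
  (∑ m, dy m (G.coeff e m) z)
    - ∑ m, z.2 m * fderiv ℝ (fun x => Real.log (dV.coeff e x)) z.1 (EuclideanSpace.single m 1)

/-- The S-curvature of `(G, dV)` as a function on `TM`. The local expression does not depend on the
coordinates; here it is evaluated in the preferred chart at the base point. -/
def sCurvature (G : Spray n M) (dV : VolumeForm n M) (v : TangentBundle (𝓡 n) M) : ℝ :=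
  sCurvatureIn G dV (chartAt (Coord n) v.proj) (tangentCoord (chartAt (Coord n) v.proj) v)

/-- A Finsler metric on `M`: a nonnegative function on `TM`, zero exactly at the zero vectors,
smooth at nonzero vectors, positively homogeneous of degree one, whose fundamental tensor
`gᵢⱼ = (1/2) ∂²(F²)/∂yⁱ∂yʲ` is positive definite at nonzero vectors. -/
structure IsFinslerMetric (F : TangentBundle (𝓡 n) M → ℝ) : Prop where
  nonneg : ∀ v, 0 ≤ F v
  eq_zero_iff : ∀ v, F v = 0 ↔ v.2 = 0
  smooth : ContMDiffOn (𝓡 n).tangent 𝓘(ℝ, ℝ) ∞ F (slit n M)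
  homogeneous : PosHomogeneous F
  posDef : ∀ e : OpenPartialHomeomorph M (Coord n), IsChart e → ∀ x ∈ e.target,
    ∀ y : Coord n, y ≠ 0 → (fundamentalTensor (fun w => F (ofCoord e w)) (x, y)).PosDef

/-- A Finsler metric `F` is projectively equivalent to a spray `G`: its spray coefficients are
`Gⁱ + P yⁱ`, where `P` is a smooth function on the nonzero tangent vectors of `M`, positively
homogeneous of degree one. -/
def ProjectivelyEquivalent (F : TangentBundle (𝓡 n) M → ℝ) (G : Spray n M) : Prop :=
  ∃ P : TangentBundle (𝓡 n) M → ℝ,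
    ContMDiffOn (𝓡 n).tangent 𝓘(ℝ, ℝ) ∞ P (slit n M) ∧ PosHomogeneous P ∧
    ∀ e : OpenPartialHomeomorph M (Coord n), IsChart e → ∀ x ∈ e.target,
      ∀ y : Coord n, y ≠ 0 → ∀ i : Fin n,
        finslerCoeff (fun w => F (ofCoord e w)) i (x, y)
          = G.coeff e i (x, y) + P (ofCoord e (x, y)) * y i

end Manifold

end SprayGeometry

end

/-! The theorem combines two local identities with one check of coordinate independence.

For a function f of (x, y), let E(f)ₖ = yʲ ∂²f/∂xʲ∂yᵏ - 2 Gʲ ∂²f/∂yʲ∂yᵏ - ∂f/∂xᵏ be its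
Euler-Lagrange expression along the spray. First, χₖ = ½ E(∂Gᵐ/∂yᵐ)ₖ (`chi_eq_eulerLagrange`):
Euler's relation collapses the contracted curvature to an expression in G, and the terms quadratic
in derivatives of G cancel in the combination of traces that defines χ. The S-curvature is ∂Gᵐ/∂yᵐ
minus the closed one-form d(ln σ), regarded as a function linear in y, and E annihilates such
functions whatever G is (`eulerLagrange_sum_snd_mul_dx`). So χ = 0 gives E(S) = 0.

Since |S| vanishes only at zero vectors, S keeps a constant sign near every nonzero vector. As E is
local and linear, E(|S|) = 0 as well. Rapcsák's criterion
(`finslerCoeff_eq_of_eulerLagrange_eq_zero`) turns this into G̃ⁱ = Gⁱ + P yⁱ with P = G(F)/(2F), F =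
|S|.

Globally, S is defined through the preferred chart at each point, so its local formula has to be
shown valid in every chart (`sCurvature_ofCoord`). Under a change of coordinates φ, the divergence
∂Gᵐ/∂yᵐ and the derivative of ln σ pick up the same trace of (Dφ)⁻¹ D²φ(y), the latter by Jacobi's
formula. The factor P is defined on TM without coordinates, as a derivative along the vector field
G; smoothness and homogeneity are then read off in one chart. -/

noncomputable section

namespace SprayGeometry

open Topology Filter Set Bundle

/-! ### Derivatives in constant directions -/

section DirDeriv

variable {E : Type*} [NormedAddCommGroup E] [NormedSpace ℝ E]

/-- The derivative of `f` in the constant direction `v`. -/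
def dirDeriv (v : E) (f : E → ℝ) (z : E) : ℝ := fderiv ℝ f z v

variable {f g : E → ℝ} {z v w : E} {U : Set E}

lemma dirDeriv_add (hf : DifferentiableAt ℝ f z) (hg : DifferentiableAt ℝ g z) :
    dirDeriv v (fun w => f w + g w) z = dirDeriv v f z + dirDeriv v g z := by
  simp [dirDeriv, fderiv_fun_add hf hg]

lemma dirDeriv_sub (hf : DifferentiableAt ℝ f z) (hg : DifferentiableAt ℝ g z) :
    dirDeriv v (fun w => f w - g w) z = dirDeriv v f z - dirDeriv v g z := by
  simp [dirDeriv, fderiv_fun_sub hf hg]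

lemma dirDeriv_neg : dirDeriv v (fun w => -f w) z = -dirDeriv v f z := by
  simp [dirDeriv, fderiv_fun_neg]

lemma dirDeriv_mul (hf : DifferentiableAt ℝ f z) (hg : DifferentiableAt ℝ g z) :
    dirDeriv v (fun w => f w * g w) z = f z * dirDeriv v g z + dirDeriv v f z * g z := by
  simp [dirDeriv, fderiv_fun_mul hf hg, mul_comm]

lemma dirDeriv_const_mul (c : ℝ) (hf : DifferentiableAt ℝ f z) :
    dirDeriv v (fun w => c * f w) z = c * dirDeriv v f z := by
  simp [dirDeriv, fderiv_const_mul hf]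

lemma dirDeriv_sum {ι : Type*} {s : Finset ι} {f : ι → E → ℝ}
    (hf : ∀ i, DifferentiableAt ℝ (f i) z) :
    dirDeriv v (fun w => ∑ i ∈ s, f i w) z = ∑ i ∈ s, dirDeriv v (f i) z := by
  simp [dirDeriv, fderiv_fun_sum fun i _ => hf i]

lemma _root_.Filter.EventuallyEq.dirDeriv_eq (h : f =ᶠ[𝓝 z] g) :
    dirDeriv v f z = dirDeriv v g z := by
  simp [dirDeriv, h.fderiv_eq]

lemma _root_.Filter.EventuallyEq.dirDeriv (h : f =ᶠ[𝓝 z] g) :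
    SprayGeometry.dirDeriv v f =ᶠ[𝓝 z] SprayGeometry.dirDeriv v g :=
  h.eventuallyEq_nhds.mono fun _ h => h.dirDeriv_eq

/-- Equality on an open set is equality near each of its points. This is what allows identities such
as Euler's relation to be differentiated repeatedly. -/
lemma eqOn_dirDeriv (hU : IsOpen U) (h : EqOn f g U) :
    EqOn (dirDeriv v f) (dirDeriv v g) U := fun _ hz =>
  (h.eventuallyEq_of_mem (hU.mem_nhds hz)).dirDeriv_eq

lemma contDiffOn_dirDeriv (hU : IsOpen U) (hf : ContDiffOn ℝ ∞ f U) :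
    ContDiffOn ℝ ∞ (dirDeriv v f) U :=
  (hf.fderiv_of_isOpen hU (by simp)).clm_apply contDiffOn_const

lemma _root_.ContDiffOn.differentiableAt_of_isOpen (hf : ContDiffOn ℝ ∞ f U) (hU : IsOpen U)
    (hz : z ∈ U) : DifferentiableAt ℝ f z :=
  (hf.differentiableOn (by simp)).differentiableAt (hU.mem_nhds hz)

lemma dirDeriv_comm (hU : IsOpen U) (hf : ContDiffOn ℝ ∞ f U) (v w : E) :
    EqOn (dirDeriv v (dirDeriv w f)) (dirDeriv w (dirDeriv v f)) U := by
  intro z hz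
  have h2 : ContDiffAt ℝ ∞ f z := hf.contDiffAt (hU.mem_nhds hz)
  have hd : DifferentiableAt ℝ (fderiv ℝ f) z :=
    (h2.fderiv_right (m := 1) (by norm_cast)).differentiableAt one_ne_zero
  have hs : IsSymmSndFDerivAt ℝ f z := h2.isSymmSndFDerivAt (by
    rw [minSmoothness_of_isRCLikeNormedField]; norm_cast)
  have key : ∀ v w : E, dirDeriv v (dirDeriv w f) z = fderiv ℝ (fderiv ℝ f) z v w := by
    intro v w
    have : HasFDerivAt (dirDeriv w f) ((fderiv ℝ (fderiv ℝ f) z).flip w) z := by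
      simpa using! hd.hasFDerivAt.clm_apply (hasFDerivAt_const w z)
    rw [dirDeriv, this.fderiv, ContinuousLinearMap.flip_apply]
  rw [key, key, hs.eq]

end DirDeriv

/-! ### Euler's relation and the Euler-Lagrange expression in coordinates -/

section Flat

variable {n : ℕ}

/-- The coordinate direction `∂/∂xᵏ`. -/
abbrev xdir (k : Fin n) : Coord n × Coord n := (EuclideanSpace.single k 1, 0)

/-- The coordinate direction `∂/∂yᵏ`. -/
abbrev ydir (k : Fin n) : Coord n × Coord n := (0, EuclideanSpace.single k 1)

lemma dx_eq_dirDeriv (k : Fin n) : dx k = dirDeriv (xdir k) := rfl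

lemma dy_eq_dirDeriv (k : Fin n) : dy k = dirDeriv (ydir k) := rfl

lemma contDiff_snd_apply (j : Fin n) :
    ContDiff ℝ ∞ (fun w : Coord n × Coord n => w.2 j) := by
  fun_prop

lemma dirDeriv_snd_apply (v : Coord n × Coord n) (j : Fin n) (z : Coord n × Coord n) :
    dirDeriv v (fun w : Coord n × Coord n => w.2 j) z = v.2 j := by
  have : HasFDerivAt (fun w : Coord n × Coord n => w.2 j)
      ((EuclideanSpace.proj (𝕜 := ℝ) j).comp (ContinuousLinearMap.snd ℝ (Coord n) (Coord n))) z :=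
    ((EuclideanSpace.proj (𝕜 := ℝ) j).comp
      (ContinuousLinearMap.snd ℝ (Coord n) (Coord n))).hasFDerivAt
  simp [dirDeriv, this.fderiv]

lemma sum_snd_mul_dirDeriv_ydir (f : Coord n × Coord n → ℝ) (z : Coord n × Coord n) (y : Coord n) :
    ∑ j, y j * dirDeriv (ydir j) f z = fderiv ℝ f z (0, y) := by
  have hy : (0, y) = ∑ j, y j • ydir j := by
    ext i
    · simp [Prod.fst_sum]
    · simp [Prod.snd_sum, Pi.single_apply]
  rw [hy, map_sum]
  simp only [map_smul, smul_eq_mul, dirDeriv]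

lemma sum_mul_dirDeriv_xdir (f : Coord n × Coord n → ℝ) (z : Coord n × Coord n) (y : Coord n) :
    ∑ j, y j * dirDeriv (xdir j) f z = fderiv ℝ f z (y, 0) := by
  have hy : (y, 0) = ∑ j, y j • xdir j := by
    ext i
    · simp [Prod.fst_sum, Pi.single_apply]
    · simp [Prod.snd_sum]
  rw [hy, map_sum]
  simp only [map_smul, smul_eq_mul, dirDeriv]

/-- Euler's relation for a function that is positively homogeneous of degree `d` in `y`. -/
lemma euler_relation {f : Coord n × Coord n → ℝ} {z : Coord n × Coord n} (d : ℕ)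
    (hf : DifferentiableAt ℝ f z)
    (hh : ∀ c : ℝ, 0 < c → f (z.1, c • z.2) = c ^ d * f z) :
    ∑ j, z.2 j * dirDeriv (ydir j) f z = d * f z := by
  rw [sum_snd_mul_dirDeriv_ydir]
  have h1 : HasDerivAt (fun c : ℝ => (z.1, c • z.2)) ((0 : Coord n), z.2) 1 := by
    have := ((hasDerivAt_id (1 : ℝ)).smul_const z.2)
    simpa using (hasDerivAt_const (1 : ℝ) z.1).prodMk this
  have hf' : HasFDerivAt f (fderiv ℝ f z) ((fun c : ℝ => (z.1, c • z.2)) 1) := by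
    simpa using hf.hasFDerivAt
  have h2 := hf'.comp_hasDerivAt (1 : ℝ) h1
  have h3 : HasDerivAt (fun c : ℝ => c ^ d * f z) (d * f z) 1 := by
    simpa using (hasDerivAt_pow d (1 : ℝ)).mul_const (f z)
  refine (h2.congr_of_eventuallyEq ?_).unique h3
  filter_upwards [lt_mem_nhds (zero_lt_one' ℝ)] with c hc
  simp [hh c hc]

lemma dirDeriv_sum_snd_mul {a : Fin n → Coord n × Coord n → ℝ} {z : Coord n × Coord n}
    (ha : ∀ j, DifferentiableAt ℝ (a j) z) (v : Coord n × Coord n) :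
    dirDeriv v (fun w => ∑ j, w.2 j * a j w) z
      = ∑ j, z.2 j * dirDeriv v (a j) z + ∑ j, v.2 j * a j z := by
  rw [dirDeriv_sum (f := fun j w => w.2 j * a j w) fun j => by fun_prop, ← Finset.sum_add_distrib]
  refine Finset.sum_congr rfl fun j _ => ?_
  rw [dirDeriv_mul (by fun_prop) (ha j), dirDeriv_snd_apply]

lemma sum_ydir_mul (k : Fin n) (a : Fin n → ℝ) : ∑ j, (ydir k).2 j * a j = a k := by
  simp

lemma sum_xdir_mul (k : Fin n) (a : Fin n → ℝ) : ∑ j, (xdir k).2 j * a j = 0 := by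
  simp

/-- The Euler-Lagrange expression `yᵐ ∂²f/∂xᵐ∂yᵏ - 2 Gᵐ ∂²f/∂yᵐ∂yᵏ - ∂f/∂xᵏ` of `f` along the
spray with coefficients `G`. -/
def eulerLagrange (G : Fin n → Coord n × Coord n → ℝ) (f : Coord n × Coord n → ℝ) (k : Fin n)
    (z : Coord n × Coord n) : ℝ :=
  ∑ j, z.2 j * dirDeriv (xdir j) (dirDeriv (ydir k) f) z
    - 2 * ∑ j, G j z * dirDeriv (ydir j) (dirDeriv (ydir k) f) z - dirDeriv (xdir k) f z

lemma eulerLagrange_congr {G : Fin n → Coord n × Coord n → ℝ} {f g : Coord n × Coord n → ℝ}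
    {z : Coord n × Coord n} (h : f =ᶠ[𝓝 z] g) (k : Fin n) :
    eulerLagrange G f k z = eulerLagrange G g k z := by
  simp only [eulerLagrange, h.dirDeriv_eq, h.dirDeriv.dirDeriv_eq]

lemma eulerLagrange_neg {G : Fin n → Coord n × Coord n → ℝ} {f : Coord n × Coord n → ℝ}
    {z : Coord n × Coord n} (k : Fin n) :
    eulerLagrange G (fun w => -f w) k z = -eulerLagrange G f k z := by
  have h (v : Coord n × Coord n) : dirDeriv v (fun w => -f w) = fun w => -dirDeriv v f w :=
    funext fun _ => dirDeriv_neg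
  simp only [eulerLagrange, h, dirDeriv_neg, mul_neg, Finset.sum_neg_distrib]
  ring

lemma eulerLagrange_sub {G : Fin n → Coord n × Coord n → ℝ} {f g : Coord n × Coord n → ℝ}
    {U : Set (Coord n × Coord n)} (hU : IsOpen U) (hf : ContDiffOn ℝ ∞ f U)
    (hg : ContDiffOn ℝ ∞ g U) {z : Coord n × Coord n} (hz : z ∈ U) (k : Fin n) :
    eulerLagrange G (fun w => f w - g w) k z = eulerLagrange G f k z - eulerLagrange G g k z := by
  have h (v : Coord n × Coord n) : EqOn (dirDeriv v (fun w => f w - g w))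
      (fun w => dirDeriv v f w - dirDeriv v g w) U := fun w hw =>
    dirDeriv_sub (hf.differentiableAt_of_isOpen hU hw) (hg.differentiableAt_of_isOpen hU hw)
  have h2 (u v : Coord n × Coord n) : dirDeriv u (dirDeriv v (fun w => f w - g w)) z
      = dirDeriv u (dirDeriv v f) z - dirDeriv u (dirDeriv v g) z := by
    rw [eqOn_dirDeriv hU (h v) hz]
    exact dirDeriv_sub ((contDiffOn_dirDeriv hU hf).differentiableAt_of_isOpen hU hz)
      ((contDiffOn_dirDeriv hU hg).differentiableAt_of_isOpen hU hz)
  simp only [eulerLagrange, h2, h _ hz, mul_sub, Finset.sum_sub_distrib]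
  ring

/-- The Euler-Lagrange expression of a closed one-form pulled back from the base vanishes. -/
lemma eulerLagrange_sum_snd_mul_dx {G : Fin n → Coord n × Coord n → ℝ}
    {h : Coord n × Coord n → ℝ} {U : Set (Coord n × Coord n)} (hU : IsOpen U)
    (hh : ContDiffOn ℝ ∞ h U) (hy : ∀ j, ∀ w ∈ U, dirDeriv (ydir j) h w = 0)
    {z : Coord n × Coord n} (hz : z ∈ U) (k : Fin n) :
    eulerLagrange G (fun w => ∑ j, w.2 j * dirDeriv (xdir j) h w) k z = 0 := by
  have hd (v : Coord n × Coord n) {w} (hw : w ∈ U) : DifferentiableAt ℝ (dirDeriv v h) w :=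
    (contDiffOn_dirDeriv hU hh).differentiableAt_of_isOpen hU hw
  have hyx (j k : Fin n) : EqOn (dirDeriv (ydir k) (dirDeriv (xdir j) h)) (fun _ => 0) U := by
    intro w hw
    rw [dirDeriv_comm hU hh _ _ hw, eqOn_dirDeriv hU (g := fun _ => 0) (hy k) hw]
    simp [dirDeriv]
  -- For f = yʲ ∂h/∂xʲ the fibre derivative ∂f/∂yᵏ is ∂h/∂xᵏ, which does not depend on y. The G-term
  -- therefore vanishes, and the two remaining terms agree by symmetry of ∂²h/∂xʲ∂xᵏ.
  have h1 : EqOn (dirDeriv (ydir k) (fun w => ∑ j, w.2 j * dirDeriv (xdir j) h w))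
      (dirDeriv (xdir k) h) U := by
    intro w hw
    rw [dirDeriv_sum_snd_mul (fun j => hd _ hw), sum_ydir_mul]
    simp [hyx _ _ hw]
  have h2 : dirDeriv (xdir k) (fun w => ∑ j, w.2 j * dirDeriv (xdir j) h w) z
      = ∑ j, z.2 j * dirDeriv (xdir j) (dirDeriv (xdir k) h) z := by
    rw [dirDeriv_sum_snd_mul (fun j => hd _ hz), sum_xdir_mul, add_zero]
    exact Finset.sum_congr rfl fun j _ => by rw [dirDeriv_comm hU hh _ _ hz]
  simp [eulerLagrange, eqOn_dirDeriv hU h1 hz, h2, hyx _ _ hz]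

end Flat

/-! ### The χ-curvature as an Euler-Lagrange expression -/

section ChiIdentity

variable {n : ℕ} {G : Fin n → Coord n × Coord n → ℝ} {U : Set (Coord n × Coord n)}
  {z : Coord n × Coord n}

/-- Euler's relation differentiated along v; the subtracted sum comes from differentiating the
factors yʲ. Fibre directions lower the degree by one, position directions preserve it. -/
lemma sum_snd_mul_dirDeriv_dirDeriv_ydir (hU : IsOpen U) {f : Coord n × Coord n → ℝ}
    (hf : ContDiffOn ℝ ∞ f U) {d : ℝ}
    (hE : ∀ z ∈ U, ∑ j, z.2 j * dirDeriv (ydir j) f z = d * f z) (v : Coord n × Coord n)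
    (hz : z ∈ U) :
    ∑ j, z.2 j * dirDeriv v (dirDeriv (ydir j) f) z
      = d * dirDeriv v f z - ∑ j, v.2 j * dirDeriv (ydir j) f z := by
  have h1 := eqOn_dirDeriv (v := v) hU
    (f := fun z => ∑ j, z.2 j * dirDeriv (ydir j) f z) (g := fun z => d * f z) hE hz
  rw [dirDeriv_sum_snd_mul
      (fun j => (contDiffOn_dirDeriv hU hf).differentiableAt_of_isOpen hU hz),
    dirDeriv_const_mul _ (hf.differentiableAt_of_isOpen hU hz)] at h1
  linarith

lemma sum_snd_mul_dirDeriv_ydir_ydir (hU : IsOpen U) {f : Coord n × Coord n → ℝ}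
    (hf : ContDiffOn ℝ ∞ f U) {d : ℝ}
    (hE : ∀ z ∈ U, ∑ j, z.2 j * dirDeriv (ydir j) f z = d * f z) (k : Fin n) (hz : z ∈ U) :
    ∑ j, z.2 j * dirDeriv (ydir j) (dirDeriv (ydir k) f) z
      = (d - 1) * dirDeriv (ydir k) f z := by
  have h := sum_snd_mul_dirDeriv_dirDeriv_ydir hU hf hE (ydir k) hz
  rw [sum_ydir_mul] at h
  rw [sub_one_mul, ← h]
  exact Finset.sum_congr rfl fun j _ => by rw [dirDeriv_comm hU hf _ _ hz]

lemma sum_snd_mul_dirDeriv_xdir_ydir (hU : IsOpen U) {f : Coord n × Coord n → ℝ}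
    (hf : ContDiffOn ℝ ∞ f U) {d : ℝ}
    (hE : ∀ z ∈ U, ∑ j, z.2 j * dirDeriv (ydir j) f z = d * f z) (k : Fin n) (hz : z ∈ U) :
    ∑ j, z.2 j * dirDeriv (xdir k) (dirDeriv (ydir j) f) z = d * dirDeriv (xdir k) f z := by
  rw [sum_snd_mul_dirDeriv_dirDeriv_ydir hU hf hE (xdir k) hz, sum_xdir_mul, sub_zero]

/-- The two-index Riemann curvature expressed through the spray coefficients:
`Rⁱₖ = 2 ∂Gⁱ/∂xᵏ - yʲ ∂²Gⁱ/∂xʲ∂yᵏ + 2 Gʲ ∂²Gⁱ/∂yʲ∂yᵏ - ∂Gⁱ/∂yʲ ∂Gʲ/∂yᵏ`. -/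
lemma riemann2_eq (hU : IsOpen U) (hG : ∀ i, ContDiffOn ℝ ∞ (G i) U)
    (hE : ∀ i, ∀ z ∈ U, ∑ j, z.2 j * dirDeriv (ydir j) (G i) z = 2 * G i z) (i k : Fin n)
    (hz : z ∈ U) :
    riemann2 G i k z = 2 * dirDeriv (xdir k) (G i) z
      - ∑ j, z.2 j * dirDeriv (xdir j) (dirDeriv (ydir k) (G i)) z
      + 2 * ∑ j, G j z * dirDeriv (ydir j) (dirDeriv (ydir k) (G i)) z
      - ∑ j, dirDeriv (ydir j) (G i) z * dirDeriv (ydir k) (G j) z := by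
  have hG1 (i k : Fin n) : ContDiffOn ℝ ∞ (dirDeriv (ydir k) (G i)) U :=
    contDiffOn_dirDeriv hU (hG i)
  have hE1 (i k : Fin n) : ∀ z ∈ U, ∑ j, z.2 j * dirDeriv (ydir j) (dirDeriv (ydir k) (G i)) z
      = 1 * dirDeriv (ydir k) (G i) z := fun z hz => by
    rw [sum_snd_mul_dirDeriv_ydir_ydir hU (hG i) (hE i) k hz]; norm_num
  -- ∂Gⁱ/∂yᵏ has degree one, so contracting its second fibre derivatives with y gives zero. This
  -- removes the N-terms of both horizontal derivatives of Γ, in `hx2` and `hx4`.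
  have hE2 (i s k : Fin n) :
      ∑ j, z.2 j * dirDeriv (ydir s) (dirDeriv (ydir j) (dirDeriv (ydir k) (G i))) z = 0 := by
    rw [sum_snd_mul_dirDeriv_dirDeriv_ydir hU (hG1 i k) (hE1 i k) (ydir s) hz, sum_ydir_mul]
    ring
  have hx1 : ∑ j, ∑ l, z.2 j * dirDeriv (xdir k) (dirDeriv (ydir j) (dirDeriv (ydir l) (G i))) z
      * z.2 l = 2 * dirDeriv (xdir k) (G i) z := by
    rw [Finset.sum_comm]
    simp_rw [← Finset.sum_mul]
    rw [← sum_snd_mul_dirDeriv_xdir_ydir hU (hG i) (hE i) k hz]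
    refine Finset.sum_congr rfl fun l _ => ?_
    rw [sum_snd_mul_dirDeriv_xdir_ydir hU (hG1 i l) (hE1 i l) k hz]
    ring
  have hx2 : ∑ j, ∑ l, z.2 j * (∑ s, dirDeriv (ydir k) (G s) z *
      dirDeriv (ydir s) (dirDeriv (ydir j) (dirDeriv (ydir l) (G i))) z) * z.2 l = 0 := by
    rw [Finset.sum_comm]
    refine Finset.sum_eq_zero fun l _ => ?_
    simp_rw [← Finset.sum_mul, Finset.mul_sum]
    rw [Finset.sum_comm, Finset.sum_eq_zero, zero_mul]
    intro s _
    rw [← mul_zero (dirDeriv (ydir k) (G s) z), ← hE2 i s l, Finset.mul_sum]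
    exact Finset.sum_congr rfl fun j _ => by ring
  have hx3 : ∑ j, ∑ l, z.2 j * dirDeriv (xdir l) (dirDeriv (ydir j) (dirDeriv (ydir k) (G i))) z
      * z.2 l = ∑ l, z.2 l * dirDeriv (xdir l) (dirDeriv (ydir k) (G i)) z := by
    rw [Finset.sum_comm]
    simp_rw [← Finset.sum_mul]
    refine Finset.sum_congr rfl fun l _ => ?_
    rw [sum_snd_mul_dirDeriv_xdir_ydir hU (hG1 i k) (hE1 i k) l hz]
    ring
  have hx4 : ∑ j, ∑ l, z.2 j * (∑ s, dirDeriv (ydir l) (G s) z *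
      dirDeriv (ydir s) (dirDeriv (ydir j) (dirDeriv (ydir k) (G i))) z) * z.2 l = 0 := by
    rw [Finset.sum_comm]
    refine Finset.sum_eq_zero fun l _ => ?_
    simp_rw [← Finset.sum_mul, Finset.mul_sum]
    rw [Finset.sum_comm, Finset.sum_eq_zero, zero_mul]
    intro s _
    rw [← mul_zero (dirDeriv (ydir l) (G s) z), ← hE2 i s k, Finset.mul_sum]
    exact Finset.sum_congr rfl fun j _ => by ring
  -- Here both factors y meet the same Γ, and Euler's relation used twice gives 2 Gˢ. In `hx6` each
  -- y meets a different Γ, which leaves a product of two N's.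
  have hx5 : ∑ j, ∑ l, z.2 j * (∑ s, dirDeriv (ydir k) (dirDeriv (ydir s) (G i)) z *
      dirDeriv (ydir j) (dirDeriv (ydir l) (G s)) z) * z.2 l
      = 2 * ∑ s, G s z * dirDeriv (ydir s) (dirDeriv (ydir k) (G i)) z := by
    have (s : Fin n) : ∑ l, ∑ j, z.2 j * dirDeriv (ydir j) (dirDeriv (ydir l) (G s)) z * z.2 l
        = 2 * G s z := by
      rw [← hE s z hz]
      refine Finset.sum_congr rfl fun l _ => ?_
      rw [← Finset.sum_mul, hE1 s l z hz]
      ring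
    simp_rw [Finset.mul_sum, Finset.sum_mul]
    rw [Finset.sum_comm, Finset.sum_congr rfl fun _ _ => Finset.sum_comm, Finset.sum_comm]
    refine Finset.sum_congr rfl fun s _ => ?_
    rw [← mul_assoc, ← this s, Finset.sum_mul, dirDeriv_comm hU (hG i) _ _ hz]
    refine Finset.sum_congr rfl fun l _ => ?_
    rw [Finset.sum_mul]
    exact Finset.sum_congr rfl fun j _ => by ring
  have hx6 : ∑ j, ∑ l, z.2 j * (∑ s, dirDeriv (ydir j) (dirDeriv (ydir k) (G s)) z *
      dirDeriv (ydir l) (dirDeriv (ydir s) (G i)) z) * z.2 l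
      = ∑ s, dirDeriv (ydir s) (G i) z * dirDeriv (ydir k) (G s) z := by
    simp_rw [Finset.mul_sum, Finset.sum_mul]
    rw [Finset.sum_comm, Finset.sum_congr rfl fun _ _ => Finset.sum_comm, Finset.sum_comm]
    refine Finset.sum_congr rfl fun s _ => ?_
    rw [← one_mul (dirDeriv (ydir s) (G i) z), ← one_mul (dirDeriv (ydir k) (G s) z),
      ← hE1 i s z hz, ← hE1 s k z hz, Finset.sum_mul]
    refine Finset.sum_congr rfl fun l _ => ?_
    rw [Finset.mul_sum]
    exact Finset.sum_congr rfl fun j _ => by ring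
  simp only [riemann2, riemann4, horiz, connN, connGamma, dx_eq_dirDeriv, dy_eq_dirDeriv,
    mul_add, add_mul, mul_sub, sub_mul, Finset.sum_add_distrib, Finset.sum_sub_distrib,
    hx1, hx2, hx3, hx4, hx5, hx6]
  ring

/-- Free indices i, k, m let the same formula serve both traces in χ: m = i for the divergence of R,
and k = i for the derivative of its trace. The isolated mixed derivative in xᵐ and yᵏ comes from
differentiating the factor yʲ. -/
lemma dirDeriv_ydir_riemann2 (hU : IsOpen U) (hG : ∀ i, ContDiffOn ℝ ∞ (G i) U)
    (hE : ∀ i, ∀ z ∈ U, ∑ j, z.2 j * dirDeriv (ydir j) (G i) z = 2 * G i z) (i k m : Fin n)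
    (hz : z ∈ U) :
    dirDeriv (ydir m) (riemann2 G i k) z = 2 * dirDeriv (xdir k) (dirDeriv (ydir m) (G i)) z
      - ∑ j, z.2 j * dirDeriv (xdir j) (dirDeriv (ydir m) (dirDeriv (ydir k) (G i))) z
      - dirDeriv (xdir m) (dirDeriv (ydir k) (G i)) z
      + 2 * ∑ j, G j z * dirDeriv (ydir j) (dirDeriv (ydir m) (dirDeriv (ydir k) (G i))) z
      + 2 * ∑ j, dirDeriv (ydir m) (G j) z * dirDeriv (ydir j) (dirDeriv (ydir k) (G i)) z
      - ∑ j, dirDeriv (ydir j) (G i) z * dirDeriv (ydir m) (dirDeriv (ydir k) (G j)) z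
      - ∑ j, dirDeriv (ydir m) (dirDeriv (ydir j) (G i)) z * dirDeriv (ydir k) (G j) z := by
  have hG1 (i : Fin n) (v) : ContDiffOn ℝ ∞ (dirDeriv v (G i)) U := contDiffOn_dirDeriv hU (hG i)
  have d0 (i : Fin n) : DifferentiableAt ℝ (G i) z := (hG i).differentiableAt_of_isOpen hU hz
  have d1 (i : Fin n) (v) : DifferentiableAt ℝ (dirDeriv v (G i)) z :=
    (hG1 i v).differentiableAt_of_isOpen hU hz
  have d2 (i : Fin n) (v w) : DifferentiableAt ℝ (dirDeriv v (dirDeriv w (G i))) z :=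
    (contDiffOn_dirDeriv hU (hG1 i w)).differentiableAt_of_isOpen hU hz
  rw [eqOn_dirDeriv hU (fun w hw => riemann2_eq hU hG hE i k hw) hz,
    dirDeriv_sub (by fun_prop) (by fun_prop), dirDeriv_add (by fun_prop) (by fun_prop),
    dirDeriv_sub (by fun_prop) (by fun_prop), dirDeriv_const_mul _ (by fun_prop),
    dirDeriv_const_mul _ (by fun_prop), dirDeriv_sum_snd_mul (fun j => d2 _ _ _), sum_ydir_mul,
    dirDeriv_sum (f := fun j w => G j w * dirDeriv (ydir j) (dirDeriv (ydir k) (G i)) w)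
      (fun j => by fun_prop),
    dirDeriv_sum (f := fun j w => dirDeriv (ydir j) (G i) w * dirDeriv (ydir k) (G j) w)
      (fun j => by fun_prop)]
  simp_rw [fun j => dirDeriv_mul (v := ydir m) (d0 j) (d2 i (ydir j) (ydir k)),
    fun j => dirDeriv_mul (v := ydir m) (d1 i (ydir j)) (d1 j (ydir k)), Finset.sum_add_distrib,
    dirDeriv_comm hU (hG i) (ydir m) (xdir k) hz,
    fun j => dirDeriv_comm hU (hG1 i (ydir k)) (ydir m) (xdir j) hz,
    fun j => dirDeriv_comm hU (hG1 i (ydir k)) (ydir m) (ydir j) hz]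
  ring

/-- The χ-curvature is half the Euler-Lagrange expression of `∂Gᵐ/∂yᵐ`. -/
theorem chi_eq_eulerLagrange (hU : IsOpen U) (hG : ∀ i, ContDiffOn ℝ ∞ (G i) U)
    (hE : ∀ i, ∀ z ∈ U, ∑ j, z.2 j * dirDeriv (ydir j) (G i) z = 2 * G i z) (k : Fin n)
    (hz : z ∈ U) :
    chi G k z = 1 / 2 * eulerLagrange G (fun w => ∑ m, dirDeriv (ydir m) (G m) w) k z := by
  have hG1 (i : Fin n) (v) : ContDiffOn ℝ ∞ (dirDeriv v (G i)) U := contDiffOn_dirDeriv hU (hG i)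
  have hs1 (v : Coord n × Coord n) : EqOn (dirDeriv v (fun w => ∑ m, dirDeriv (ydir m) (G m) w))
      (fun w => ∑ m, dirDeriv v (dirDeriv (ydir m) (G m)) w) U := fun w hw =>
    dirDeriv_sum fun m => (hG1 m _).differentiableAt_of_isOpen hU hw
  have hs2 (u v : Coord n × Coord n) :
      dirDeriv u (dirDeriv v (fun w => ∑ m, dirDeriv (ydir m) (G m) w)) z
        = ∑ m, dirDeriv u (dirDeriv v (dirDeriv (ydir m) (G m))) z := by
    rw [eqOn_dirDeriv hU (hs1 v) hz]
    exact dirDeriv_sum fun m =>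
      (contDiffOn_dirDeriv hU (hG1 m _)).differentiableAt_of_isOpen hU hz
  have hc (m k : Fin n) (v : Coord n × Coord n) :
      dirDeriv v (dirDeriv (ydir m) (dirDeriv (ydir k) (G m))) z
        = dirDeriv v (dirDeriv (ydir k) (dirDeriv (ydir m) (G m))) z :=
    eqOn_dirDeriv hU (dirDeriv_comm hU (hG m) _ _) hz
  -- After tracing, the quadratic terms are multiples of two double sums: ∂Gʲ/∂yᵐ ∂²Gᵐ/∂yʲ∂yᵏ
  -- (`hsw1` to `hsw3`) and ∂Gʲ/∂yᵏ ∂²Gᵐ/∂yʲ∂yᵐ (`hsw4`). With the weights 2 and 1 of χ their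
  -- coefficients are 4 - 2 - 1 - 1 and -2 + 2, so both cancel, as do the terms ∂²Gᵐ/∂xᵐ∂yᵏ.
  have hsw1 : ∑ m, ∑ j, dirDeriv (ydir j) (G m) z * dirDeriv (ydir m) (dirDeriv (ydir k) (G j)) z
      = ∑ m, ∑ j, dirDeriv (ydir m) (G j) z * dirDeriv (ydir j) (dirDeriv (ydir k) (G m)) z :=
    Finset.sum_comm
  have hsw2 : ∑ m, ∑ j, dirDeriv (ydir k) (dirDeriv (ydir j) (G m)) z * dirDeriv (ydir m) (G j) z
      = ∑ m, ∑ j, dirDeriv (ydir m) (G j) z * dirDeriv (ydir j) (dirDeriv (ydir k) (G m)) z := by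
    refine Finset.sum_congr rfl fun m _ => Finset.sum_congr rfl fun j _ => ?_
    rw [dirDeriv_comm hU (hG m) _ _ hz, mul_comm]
  have hsw3 : ∑ m, ∑ j, dirDeriv (ydir j) (G m) z * dirDeriv (ydir k) (dirDeriv (ydir m) (G j)) z
      = ∑ m, ∑ j, dirDeriv (ydir m) (G j) z * dirDeriv (ydir j) (dirDeriv (ydir k) (G m)) z := by
    rw [← hsw1]
    refine Finset.sum_congr rfl fun m _ => Finset.sum_congr rfl fun j _ => ?_
    rw [dirDeriv_comm hU (hG j) _ _ hz]
  have hsw4 : ∑ m, ∑ j, dirDeriv (ydir m) (dirDeriv (ydir j) (G m)) z * dirDeriv (ydir k) (G j) z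
      = ∑ m, ∑ j, dirDeriv (ydir k) (G j) z * dirDeriv (ydir j) (dirDeriv (ydir m) (G m)) z := by
    refine Finset.sum_congr rfl fun m _ => Finset.sum_congr rfl fun j _ => ?_
    rw [dirDeriv_comm hU (hG m) _ _ hz, mul_comm]
  have hx : ∑ m, dirDeriv (xdir k) (dirDeriv (ydir m) (G m)) z
      = dirDeriv (xdir k) (fun w => ∑ m, dirDeriv (ydir m) (G m) w) z := (hs1 _ hz).symm
  have ha : ∑ m, ∑ j, z.2 j * dirDeriv (xdir j) (dirDeriv (ydir k) (dirDeriv (ydir m) (G m))) z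
      = ∑ j, z.2 j *
        dirDeriv (xdir j) (dirDeriv (ydir k) (fun w => ∑ m, dirDeriv (ydir m) (G m) w)) z := by
    rw [Finset.sum_comm]
    simp_rw [hs2, Finset.mul_sum]
  have hb : ∑ m, ∑ j, G j z * dirDeriv (ydir j) (dirDeriv (ydir k) (dirDeriv (ydir m) (G m))) z
      = ∑ j, G j z *
        dirDeriv (ydir j) (dirDeriv (ydir k) (fun w => ∑ m, dirDeriv (ydir m) (G m) w)) z := by
    rw [Finset.sum_comm]
    simp_rw [hs2, Finset.mul_sum]
  simp only [chi, eulerLagrange, dy_eq_dirDeriv,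
    fun i k m => dirDeriv_ydir_riemann2 hU hG hE i k m hz, hc, Finset.sum_add_distrib,
    Finset.sum_sub_distrib, ← Finset.mul_sum, mul_add, mul_sub, hsw1, hsw2, hsw3, hsw4, hx, ha, hb]
  ring

end ChiIdentity

/-! ### Rapcsák's criterion -/

section Rapcsak

variable {n : ℕ} {G : Fin n → Coord n × Coord n → ℝ} {U : Set (Coord n × Coord n)}
  {F : Coord n × Coord n → ℝ} {z : Coord n × Coord n}

/-- The derivative of `f` along the spray `yʲ ∂/∂xʲ - 2 Gʲ ∂/∂yʲ`. -/
def sprayDeriv (G : Fin n → Coord n × Coord n → ℝ) (f : Coord n × Coord n → ℝ)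
    (z : Coord n × Coord n) : ℝ :=
  ∑ j, z.2 j * dirDeriv (xdir j) f z - 2 * ∑ j, G j z * dirDeriv (ydir j) f z

/-- Rapcsák's criterion: if the Euler-Lagrange expression of `F` along a spray `G` vanishes, then
the spray of `F` is projectively equivalent to `G`. -/
theorem finslerCoeff_eq_of_eulerLagrange_eq_zero (hU : IsOpen U) (hF : ContDiffOn ℝ ∞ F U)
    (hE : ∀ z ∈ U, ∑ j, z.2 j * dirDeriv (ydir j) F z = F z) (hz : z ∈ U) (h0 : F z ≠ 0)
    (hEL : ∀ k, eulerLagrange G F k z = 0) (hg : (fundamentalTensor F z).PosDef) (i : Fin n) :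
    finslerCoeff F i z = G i z + sprayDeriv G F z / (2 * F z) * z.2 i := by
  have hd1 (v : Coord n × Coord n) : EqOn (dirDeriv v (fun w => F w ^ 2))
      (fun w => 2 * (F w * dirDeriv v F w)) U := fun w hw => by
    have hd := hF.differentiableAt_of_isOpen hU hw
    simp only [sq]
    rw [dirDeriv_mul hd hd]
    ring
  have hd2 (u v : Coord n × Coord n) : dirDeriv u (dirDeriv v (fun w => F w ^ 2)) z
      = 2 * (F z * dirDeriv u (dirDeriv v F) z + dirDeriv u F z * dirDeriv v F z) := by
    have hd := hF.differentiableAt_of_isOpen hU hz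
    have hd' := (contDiffOn_dirDeriv (v := v) hU hF).differentiableAt_of_isOpen hU hz
    rw [eqOn_dirDeriv hU (hd1 v) hz,
      dirDeriv_const_mul 2 (f := fun w => F w * dirDeriv v F w) (by fun_prop),
      dirDeriv_mul hd hd']
  -- The vector y lies in the kernel of the fibre Hessian of F, as ∂F/∂yˡ has degree zero. Hence P y
  -- contributes to g(G + P y) only through ∂F/∂yˡ.
  have hE' (l : Fin n) : ∑ j, z.2 j * dirDeriv (ydir l) (dirDeriv (ydir j) F) z = 0 := by
    have := sum_snd_mul_dirDeriv_ydir_ydir hU hF (d := 1) (by simpa using hE) l hz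
    rw [sub_self, zero_mul] at this
    rw [← this]
    exact Finset.sum_congr rfl fun j _ => by rw [dirDeriv_comm hU hF _ _ hz]
  set P := sprayDeriv G F z / (2 * F z) with hP
  have hP' : 2 * F z * P = sprayDeriv G F z := by rw [hP]; field_simp
  -- It suffices to prove the spray equation with the index lowered by g. Expanding F² leaves a term
  -- F · E(F), which is zero, and multiples of ∂F/∂yˡ; matching the latter forces P = G(F)/(2F).
  have key (l : Fin n) : (∑ k, dx k (dy l (fun w => F w ^ 2)) z * z.2 k)
      - dx l (fun w => F w ^ 2) z
      = 4 * (fundamentalTensor F z).mulVec (fun j => G j z + P * z.2 j) l := by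
    have hL : (∑ k, dx k (dy l (fun w => F w ^ 2)) z * z.2 k)
        = 2 * F z * ∑ k, z.2 k * dirDeriv (xdir k) (dirDeriv (ydir l) F) z
          + 2 * dirDeriv (ydir l) F z * ∑ k, z.2 k * dirDeriv (xdir k) F z := by
      simp only [dx_eq_dirDeriv, dy_eq_dirDeriv, hd2, Finset.mul_sum, ← Finset.sum_add_distrib]
      exact Finset.sum_congr rfl fun k _ => by ring
    have hR : (fundamentalTensor F z).mulVec (fun j => G j z + P * z.2 j) l
        = F z * ∑ j, G j z * dirDeriv (ydir j) (dirDeriv (ydir l) F) z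
          + dirDeriv (ydir l) F z * ∑ j, G j z * dirDeriv (ydir j) F z
          + P * F z * ∑ j, z.2 j * dirDeriv (ydir l) (dirDeriv (ydir j) F) z
          + P * dirDeriv (ydir l) F z * ∑ j, z.2 j * dirDeriv (ydir j) F z := by
      simp only [Matrix.mulVec, dotProduct, fundamentalTensor, Matrix.of_apply, dy_eq_dirDeriv,
        hd2, Finset.mul_sum, ← Finset.sum_add_distrib]
      refine Finset.sum_congr rfl fun j _ => ?_
      rw [dirDeriv_comm hU hF (ydir l) (ydir j) hz]
      ring
    have h := hEL l
    rw [eulerLagrange] at h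
    rw [sprayDeriv] at hP'
    rw [hL, hR, hE', hE z hz, dx_eq_dirDeriv, hd1 _ hz]
    linear_combination 2 * F z * h - 2 * dirDeriv (ydir l) F z * hP'
  have hdet : IsUnit (fundamentalTensor F z).det := hg.det_pos.ne'.isUnit
  have hinv := congrFun (Matrix.mulVec_mulVec (fun j => G j z + P * z.2 j)
    (fundamentalTensor F z)⁻¹ (fundamentalTensor F z)) i
  rw [Matrix.nonsing_inv_mul _ hdet, Matrix.one_mulVec] at hinv
  simp only [finslerCoeff, key]
  rw [← hinv, Matrix.mulVec, dotProduct, Finset.mul_sum]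
  exact Finset.sum_congr rfl fun l _ => by ring

/-- The derivative along a spray of a function that is positively homogeneous of degree one is
positively homogeneous of degree two. -/
lemma sprayDeriv_smul {x y : Coord n} {c : ℝ} (hc : 0 < c)
    (hF : ∀ᶠ w in 𝓝 (x, y), F (w.1, c • w.2) = c * F w)
    (hd : DifferentiableAt ℝ F (x, c • y))
    (hG : ∀ i, G i (x, c • y) = c ^ 2 * G i (x, y)) :
    sprayDeriv G F (x, c • y) = c ^ 2 * sprayDeriv G F (x, y) := by
  -- The fibre dilation. Differentiating F ∘ T = c F shows that x-derivatives of F scale by c and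
  -- y-derivatives are unchanged.
  let T : Coord n × Coord n →L[ℝ] Coord n × Coord n :=
    (ContinuousLinearMap.id ℝ (Coord n)).prodMap (c • ContinuousLinearMap.id ℝ (Coord n))
  have hT (w : Coord n × Coord n) : T w = (w.1, c • w.2) := rfl
  have h1 : fderiv ℝ F (x, c • y) ∘L T = fderiv ℝ (fun w => c * F w) (x, y) := by
    rw [← Filter.EventuallyEq.fderiv_eq hF]
    have : HasFDerivAt F (fderiv ℝ F (x, c • y)) (T (x, y)) := hd.hasFDerivAt
    exact (this.comp (x, y) T.hasFDerivAt).fderiv.symm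
  have h2 : fderiv ℝ (fun w => c * F w) (x, y) = c • fderiv ℝ F (x, y) := by
    simpa using! congrFun (fderiv_const_smul_field (𝕜 := ℝ) (f := F) c) (x, y)
  have h3 (v : Coord n × Coord n) :
      fderiv ℝ F (x, c • y) (v.1, c • v.2) = c * fderiv ℝ F (x, y) v := by
    have := congrArg (fun L => L v) (h1.trans h2)
    simpa [hT] using this
  have hx (j : Fin n) : dirDeriv (xdir j) F (x, c • y) = c * dirDeriv (xdir j) F (x, y) := by
    simpa [dirDeriv] using h3 (xdir j)
  have hy (j : Fin n) : dirDeriv (ydir j) F (x, c • y) = dirDeriv (ydir j) F (x, y) := by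
    have := h3 (ydir j)
    have he : ((ydir j).1, c • (ydir j).2) = c • ydir j := by simp
    rw [he, map_smul, smul_eq_mul] at this
    exact mul_left_cancel₀ hc.ne' this
  simp only [sprayDeriv, hx, hy, hG, PiLp.smul_apply, smul_eq_mul, mul_sub, Finset.mul_sum]
  congr 1 <;> exact Finset.sum_congr rfl fun j _ => by ring

end Rapcsak

lemma trace_eq_sum_apply {n : ℕ} (T : Coord n →ₗ[ℝ] Coord n) :
    LinearMap.trace ℝ (Coord n) T = ∑ m, T (EuclideanSpace.single m 1) m := by
  rw [LinearMap.trace_eq_matrix_trace ℝ (EuclideanSpace.basisFun (Fin n) ℝ).toBasis]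
  simp [Matrix.trace, LinearMap.toMatrix_apply]

/-! ### Derivative of the determinant -/

section Jacobi

variable {V : Type*} [NormedAddCommGroup V] [NormedSpace ℝ V] [FiniteDimensional ℝ V]

lemma differentiable_det :
    Differentiable ℝ (fun A : V →L[ℝ] V => LinearMap.det (A : V →ₗ[ℝ] V)) := by
  let b := Module.finBasis ℝ V
  have h (A : V →L[ℝ] V) : LinearMap.det (A : V →ₗ[ℝ] V)
      = ∑ σ : Equiv.Perm (Fin (Module.finrank ℝ V)), ((Equiv.Perm.sign σ : ℤ) : ℝ) *
        ∏ i, LinearMap.toContinuousLinearMap (b.coord (σ i)) (A (b i)) := by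
    rw [← LinearMap.det_toMatrix b, Matrix.det_apply']
    simp [LinearMap.toMatrix_apply]
  simp_rw [h]
  fun_prop

/-- Differentiability is already known, so the derivative is determined along lines, where det(1 +
tT) = 1 + t tr T + O(t²). -/
lemma hasFDerivAt_det_one :
    HasFDerivAt (fun A : V →L[ℝ] V => LinearMap.det (A : V →ₗ[ℝ] V))
      (LinearMap.toContinuousLinearMap
        (LinearMap.trace ℝ V ∘ₗ ContinuousLinearMap.coeLM ℝ)) 1 := by
  have hd := (differentiable_det (V := V) 1).hasFDerivAt
  convert hd using 1
  ext T
  have h1 : HasDerivAt (fun t : ℝ => (1 : V →L[ℝ] V) + t • T) T 0 := by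
    simpa using ((hasDerivAt_id (0 : ℝ)).smul_const T).const_add 1
  have hd' := hd
  rw [show (1 : V →L[ℝ] V) = 1 + (0 : ℝ) • T by rw [zero_smul, add_zero]] at hd'
  have h2 := hd'.comp_hasDerivAt (0 : ℝ) h1
  let b := Module.finBasis ℝ V
  have hdet (t : ℝ) : LinearMap.det ((1 + t • T : V →L[ℝ] V) : V →ₗ[ℝ] V)
      = Matrix.det (1 + t • LinearMap.toMatrix b b (T : V →ₗ[ℝ] V)) := by
    rw [← LinearMap.det_toMatrix b, ContinuousLinearMap.toLinearMap_add, map_add,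
      ContinuousLinearMap.toLinearMap_smul, map_smul]
    congr 2
    exact LinearMap.toMatrix_one b
  -- Applying `divX` twice drops the coefficients of 1 and t, leaving the cofactor of t² in det(1 +
  -- tT).
  let q := (Matrix.det (1 + (Polynomial.X : Polynomial ℝ) •
    (LinearMap.toMatrix b b (T : V →ₗ[ℝ] V)).map Polynomial.C)).divX.divX
  have h3 : HasDerivAt (fun t : ℝ => 1 + LinearMap.trace ℝ V T * t + q.eval t * t ^ 2)
      (LinearMap.trace ℝ V T) 0 := by
    have := (((hasDerivAt_id (0 : ℝ)).const_mul (LinearMap.trace ℝ V T)).const_add 1).add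
      ((q.hasDerivAt 0).mul (hasDerivAt_pow 2 (0 : ℝ)))
    simpa using! this
  have h4 : (fun A : V →L[ℝ] V => LinearMap.det (A : V →ₗ[ℝ] V)) ∘
      (fun t : ℝ => (1 : V →L[ℝ] V) + t • T)
      = fun t : ℝ => 1 + LinearMap.trace ℝ V T * t + q.eval t * t ^ 2 := by
    funext t
    rw [Function.comp_apply, hdet, Matrix.det_one_add_smul,
      LinearMap.trace_eq_matrix_trace ℝ b (T : V →ₗ[ℝ] V)]
  rw [h4] at h2
  have h5 := h3.unique h2
  rw [zero_smul, add_zero] at h5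
  exact h5

/-- Jacobi's formula for the logarithmic derivative of a determinant. -/
lemma hasFDerivAt_log_abs_det {E : Type*} [NormedAddCommGroup E] [NormedSpace ℝ E]
    {A : E → V →L[ℝ] V} {A' : E →L[ℝ] V →L[ℝ] V} {x : E}
    (hA : HasFDerivAt A A' x) {B : V →L[ℝ] V} (hB : B * A x = 1) :
    HasFDerivAt (fun w => Real.log |LinearMap.det (A w : V →ₗ[ℝ] V)|)
      ((LinearMap.toContinuousLinearMap
        (LinearMap.trace ℝ V ∘ₗ ContinuousLinearMap.coeLM ℝ)) ∘L
        (ContinuousLinearMap.mul ℝ _ B) ∘L A') x := by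
  have hdetB : LinearMap.det (B : V →ₗ[ℝ] V) *
      LinearMap.det (A x : V →ₗ[ℝ] V) = 1 := by
    rw [← LinearMap.det_comp]
    exact (congrArg (fun T : V →L[ℝ] V => LinearMap.det (T : V →ₗ[ℝ] V))
      hB).trans LinearMap.det_id
  have hBA : HasFDerivAt (fun w => B * A w) ((ContinuousLinearMap.mul ℝ _ B) ∘L A') x :=
    (ContinuousLinearMap.mul ℝ _ B).hasFDerivAt.comp x hA
  have h1 : HasFDerivAt (fun A : V →L[ℝ] V => LinearMap.det (A : V →ₗ[ℝ] V))
      (LinearMap.toContinuousLinearMap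
        (LinearMap.trace ℝ V ∘ₗ ContinuousLinearMap.coeLM ℝ)) (B * A x) := by
    rw [hB]
    exact hasFDerivAt_det_one
  have h2 := h1.comp x hBA
  have hone : LinearMap.det ((B * A x : V →L[ℝ] V) : V →ₗ[ℝ] V) = 1 := by
    rw [hB]
    exact LinearMap.det_id
  -- Multiplication by the fixed B moves the base point to the identity and changes log |det A| only
  -- by a constant. Since `Real.log` ignores signs, the sign of det A never matters.
  have h3 := (h2.log (by rw [Function.comp_apply, hone]; exact one_ne_zero)).sub_const
    (Real.log (LinearMap.det (B : V →ₗ[ℝ] V)))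
  rw [Function.comp_apply, hone, inv_one, one_smul] at h3
  refine h3.congr_of_eventuallyEq ?_
  have hcont : ContinuousAt (fun w => LinearMap.det (A w : V →ₗ[ℝ] V)) x :=
    (differentiable_det (A x)).continuousAt.comp hA.continuousAt
  filter_upwards [hcont.eventually_ne (right_ne_zero_of_mul_eq_one hdetB)] with w hw
  have : LinearMap.det ((B * A w : V →L[ℝ] V) : V →ₗ[ℝ] V)
      = LinearMap.det (B : V →ₗ[ℝ] V) * LinearMap.det (A w : V →ₗ[ℝ] V) :=
    LinearMap.det_comp _ _
  rw [Function.comp_apply, this, Real.log_abs, Real.log_mul (left_ne_zero_of_mul_eq_one hdetB) hw]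
  ring

end Jacobi

/-! ### Changes of induced coordinates on the tangent bundle -/

/-- The effect of a change of coordinates on the fibre divergence of a spray. -/
lemma trace_fderiv_snd_of_transform {V : Type*} [NormedAddCommGroup V]
    [NormedSpace ℝ V] {c c' : V × V → V} {x x' y : V}
    {A B : V →L[ℝ] V} {Q : V →L[ℝ] V →L[ℝ] V}
    (hQ : ∀ u v, Q u v = Q v u) (hBA : B * A = 1) (hAB : A * B = 1)
    (hc : DifferentiableAt ℝ c (x, y)) (hc' : DifferentiableAt ℝ c' (x', A y))
    (h : ∀ u, c' (x', A u) = Q u u + A (c (x, u))) :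
    LinearMap.trace ℝ V (fderiv ℝ c' (x', A y) ∘L ContinuousLinearMap.inr ℝ V V : V →L[ℝ] V)
      = 2 * LinearMap.trace ℝ V (B * Q y : V →L[ℝ] V)
        + LinearMap.trace ℝ V (fderiv ℝ c (x, y) ∘L ContinuousLinearMap.inr ℝ V V : V →L[ℝ] V) := by
  let D : V →L[ℝ] V := fderiv ℝ c (x, y) ∘L ContinuousLinearMap.inr ℝ _ _
  let D' : V →L[ℝ] V := fderiv ℝ c' (x', A y) ∘L ContinuousLinearMap.inr ℝ _ _
  have hp (a b : V) : HasFDerivAt (fun u : V => (a, u))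
      (ContinuousLinearMap.inr ℝ (V) (V)) b := hasFDerivAt_prodMk_right a b
  have h1 : HasFDerivAt (fun u => c' (x', A u)) (D' ∘L A) y :=
    (hc'.hasFDerivAt.comp (A y) (hp x' (A y))).comp y A.hasFDerivAt
  have h2 : HasFDerivAt (fun u => Q u u + A (c (x, u))) ((2 : ℝ) • Q y + A ∘L D) y := by
    have hq : HasFDerivAt (fun u => Q u u) ((2 : ℝ) • Q y) y := by
      have := Q.hasFDerivAt (x := y) |>.clm_apply (hasFDerivAt_id y)
      refine this.congr_fderiv ?_
      ext u
      simp [hQ u y, two_smul]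
    exact hq.add (A.hasFDerivAt.comp y (hc.hasFDerivAt.comp y (hp x y)))
  -- Both sides of the transformation law are differentiated in the fibre variable; the quadratic
  -- term contributes 2 Q y. Conjugation by A then disappears under the trace.
  have h3 : D' ∘L A = (2 : ℝ) • Q y + A ∘L D := by
    rw [show (fun u => c' (x', A u)) = fun u => Q u u + A (c (x, u)) from funext h] at h1
    exact h1.unique h2
  have h4 : D' = (2 : ℝ) • (Q y * B) + A * D * B := by
    have := congrArg (fun T : V →L[ℝ] V => T * B) h3
    change D' * A * B = ((2 : ℝ) • Q y + A * D) * B at this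
    rw [mul_assoc, hAB, mul_one, add_mul] at this
    exact this
  have h5 := congrArg (fun T : V →L[ℝ] V => LinearMap.trace ℝ V T) h4
  have hm1 : LinearMap.trace ℝ V ((Q y * B : V →L[ℝ] V) : V →ₗ[ℝ] V)
      = LinearMap.trace ℝ V ((B * Q y : V →L[ℝ] V) : V →ₗ[ℝ] V) :=
    LinearMap.trace_mul_comm ℝ (Q y : V →ₗ[ℝ] V) (B : V →ₗ[ℝ] V)
  have hm2 : LinearMap.trace ℝ V ((A * D * B : V →L[ℝ] V) : V →ₗ[ℝ] V)
      = LinearMap.trace ℝ V ((D : V →L[ℝ] V) : V →ₗ[ℝ] V) := by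
    have := LinearMap.trace_mul_comm ℝ ((A * D : V →L[ℝ] V) : V →ₗ[ℝ] V)
      (B : V →ₗ[ℝ] V)
    refine this.trans ?_
    rw [show (B : V →ₗ[ℝ] V) * ((A * D : V →L[ℝ] V) : V →ₗ[ℝ] V)
      = ((B * A * D : V →L[ℝ] V) : V →ₗ[ℝ] V) from rfl, hBA, one_mul]
  simp only [ContinuousLinearMap.toLinearMap_add, ContinuousLinearMap.toLinearMap_smul, map_add,
    map_smul, hm1, hm2, smul_eq_mul] at h5
  exact h5

section TangentMap

variable {V : Type*} [NormedAddCommGroup V] [NormedSpace ℝ V] {φ : V → V} {z : V × V}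

lemma hasFDerivAt_prodMk_fderiv_apply (hφ : ContDiffAt ℝ ∞ φ z.1) :
    HasFDerivAt (fun w : V × V => (φ w.1, fderiv ℝ φ w.1 w.2))
      ((fderiv ℝ φ z.1 ∘L ContinuousLinearMap.fst ℝ V V).prod
        (fderiv ℝ φ z.1 ∘L ContinuousLinearMap.snd ℝ V V
          + (fderiv ℝ (fderiv ℝ φ) z.1 ∘L ContinuousLinearMap.fst ℝ V V).flip z.2)) z := by
  have h1 : HasFDerivAt φ (fderiv ℝ φ z.1) z.1 := (hφ.differentiableAt (by simp)).hasFDerivAt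
  have h2 : HasFDerivAt (fderiv ℝ φ) (fderiv ℝ (fderiv ℝ φ) z.1) z.1 :=
    ((hφ.fderiv_right (m := 1) (by norm_cast)).differentiableAt one_ne_zero).hasFDerivAt
  exact (h1.comp z hasFDerivAt_fst).prodMk ((h2.comp z hasFDerivAt_fst).clm_apply hasFDerivAt_snd)

lemma fderiv_prodMk_fderiv_apply (hφ : ContDiffAt ℝ ∞ φ z.1) (w : V × V) :
    fderiv ℝ (fun w : V × V => (φ w.1, fderiv ℝ φ w.1 w.2)) z w
      = (fderiv ℝ φ z.1 w.1, fderiv ℝ φ z.1 w.2 + fderiv ℝ (fderiv ℝ φ) z.1 w.1 z.2) := by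
  rw [(hasFDerivAt_prodMk_fderiv_apply hφ).fderiv]
  rfl

end TangentMap

section Charts

variable {n : ℕ} {M : Type*} [TopologicalSpace M] [ChartedSpace (Coord n) M]
  {e e' : OpenPartialHomeomorph M (Coord n)}

/-- All tangent spaces unfold to the model space, so vectors at propositionally equal base points
can be compared there without transport. -/
lemma tangentBundle_mk_eq {p q : M} (h : p = q) {v : TangentSpace (𝓡 n) p}
    {w : TangentSpace (𝓡 n) q} (hvw : (v : Coord n) = w) :
    (⟨p, v⟩ : TangentBundle (𝓡 n) M) = ⟨q, w⟩ := by
  subst h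
  exact congrArg _ hvw

lemma mdifferentiable_of_isChart (he : IsChart e) : e.MDifferentiable (𝓡 n) (𝓡 n) :=
  ⟨(contMDiffOn_of_mem_maximalAtlas he).mdifferentiableOn (by simp),
    (contMDiffOn_symm_of_mem_maximalAtlas he).mdifferentiableOn (by simp)⟩

lemma tangentCoord_ofCoord (he : IsChart e) {z : Coord n × Coord n} (hz : z.1 ∈ e.target) :
    tangentCoord e (ofCoord e z) = z := by
  refine Prod.ext (e.right_inv hz) ?_
  exact congrArg (fun L => L z.2) ((mdifferentiable_of_isChart he).comp_symm_deriv hz)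

lemma ofCoord_tangentCoord (he : IsChart e) {v : TangentBundle (𝓡 n) M} (hv : v.proj ∈ e.source) :
    ofCoord e (tangentCoord e v) = v :=
  tangentBundle_mk_eq (e.left_inv hv)
    (congrArg (fun L => L v.2) ((mdifferentiable_of_isChart he).symm_comp_deriv hv))

lemma ofCoord_snd_eq_zero_iff (he : IsChart e) {x y : Coord n} (hx : x ∈ e.target) :
    (ofCoord e (x, y)).2 = 0 ↔ y = 0 := by
  have h := (mdifferentiable_of_isChart he).symm.mfderiv_injective hx
  refine ⟨fun h0 => h (h0.trans (map_zero _).symm), fun h0 => ?_⟩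
  subst h0
  exact map_zero _

lemma tangentCoord_snd_eq_zero_iff (he : IsChart e) {v : TangentBundle (𝓡 n) M}
    (hv : v.proj ∈ e.source) : (tangentCoord e v).2 = 0 ↔ v.2 = 0 := by
  have h := (mdifferentiable_of_isChart he).mfderiv_injective hv
  have hz := (mfderiv (𝓡 n) (𝓡 n) e v.proj).map_zero
  exact ⟨fun h0 => h (h0.trans hz.symm), fun h0 =>
    (congrArg (mfderiv (𝓡 n) (𝓡 n) e v.proj) h0).trans hz⟩

/-- The change of coordinates from `e` to `e'`. -/
def transition (e e' : OpenPartialHomeomorph M (Coord n)) : Coord n → Coord n := e' ∘ e.symm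

lemma contDiffAt_transition (he : IsChart e) (he' : IsChart e') {x : Coord n} (hx : x ∈ e.target)
    (hx' : e.symm x ∈ e'.source) : ContDiffAt ℝ ∞ (transition e e') x :=
  ((contMDiffAt_of_mem_maximalAtlas he' hx').comp x
    (contMDiffAt_symm_of_mem_maximalAtlas he hx)).contDiffAt

lemma fderiv_transition (he : IsChart e) (he' : IsChart e') {x : Coord n} (hx : x ∈ e.target)
    (hx' : e.symm x ∈ e'.source) (y : Coord n) :
    fderiv ℝ (transition e e') x y
      = mfderiv (𝓡 n) (𝓡 n) e' (e.symm x) (mfderiv (𝓡 n) (𝓡 n) e.symm x y) := by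
  have h := mfderiv_comp x ((mdifferentiable_of_isChart he').mdifferentiableAt hx')
    ((mdifferentiable_of_isChart he).mdifferentiableAt_symm hx)
  rw [← mfderiv_eq_fderiv]
  exact congrArg (fun L => L y) h

/-- The change of induced coordinates from `e` to `e'`. -/
def tangentTransition (e e' : OpenPartialHomeomorph M (Coord n)) (z : Coord n × Coord n) :
    Coord n × Coord n :=
  (transition e e' z.1, fderiv ℝ (transition e e') z.1 z.2)

lemma tangentCoord_ofCoord_of_isChart (he : IsChart e) (he' : IsChart e') {z : Coord n × Coord n}
    (hz : z.1 ∈ e.target) (hz' : e.symm z.1 ∈ e'.source) :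
    tangentCoord e' (ofCoord e z) = tangentTransition e e' z :=
  Prod.ext rfl (fderiv_transition he he' hz hz' z.2).symm

lemma tangentTransition_tangentCoord (he : IsChart e) (he' : IsChart e')
    {v : TangentBundle (𝓡 n) M} (hv : v.proj ∈ e.source) (hv' : v.proj ∈ e'.source) :
    tangentTransition e e' (tangentCoord e v) = tangentCoord e' v := by
  rw [← tangentCoord_ofCoord_of_isChart he he' (e.map_source hv)
      (show e.symm (e v.proj) ∈ e'.source by rwa [e.left_inv hv]),
    ofCoord_tangentCoord he hv]

variable [IsManifold (𝓡 n) ∞ M]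

lemma contMDiffOn_tangentCoord (he : IsChart e) :
    ContMDiffOn (𝓡 n).tangent 𝓘(ℝ, Coord n × Coord n) ∞ (tangentCoord e)
      (TotalSpace.proj ⁻¹' e.source) := by
  have he' := contMDiffOn_of_mem_maximalAtlas he
  have h1 : ContMDiffOn (𝓡 n).tangent (𝓡 n) ∞ (fun v : TangentBundle (𝓡 n) M => e v.proj)
      (TotalSpace.proj ⁻¹' e.source) :=
    he'.comp (contMDiff_proj (TangentSpace (𝓡 n))).contMDiffOn fun _ h => h
  have h2 : ContMDiffOn (𝓡 n).tangent (𝓡 n).tangent ∞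
      (tangentMapWithin (𝓡 n) (𝓡 n) e e.source) (TotalSpace.proj ⁻¹' e.source) :=
    he'.contMDiffOn_tangentMapWithin (by simp) e.open_source.uniqueMDiffOn
  have h3 := (contMDiff_snd_tangentBundle_modelSpace (Coord n) (𝓡 n) (n := ∞)).comp_contMDiffOn h2
  refine (h1.prodMk_space h3).congr fun v hv => ?_
  refine Prod.ext rfl ?_
  change mfderiv (𝓡 n) (𝓡 n) e v.proj v.2 = mfderivWithin (𝓡 n) (𝓡 n) e e.source v.proj v.2
  rw [mfderivWithin_of_isOpen e.open_source hv]

lemma isOpen_proj_preimage (e : OpenPartialHomeomorph M (Coord n)) :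
    IsOpen (TotalSpace.proj ⁻¹' e.source : Set (TangentBundle (𝓡 n) M)) :=
  e.open_source.preimage (FiberBundle.continuous_proj (Coord n) (TangentSpace (𝓡 n)))

lemma contMDiffAt_tangentCoord (he : IsChart e) {v : TangentBundle (𝓡 n) M}
    (hv : v.proj ∈ e.source) :
    ContMDiffAt (𝓡 n).tangent 𝓘(ℝ, Coord n × Coord n) ∞ (tangentCoord e) v :=
  (contMDiffOn_tangentCoord he).contMDiffAt ((isOpen_proj_preimage e).mem_nhds hv)

/-- The transformation law of the components of a vector field on `TM`. -/
lemma fieldCoord_tangentTransition (X : ∀ v : TangentBundle (𝓡 n) M, TangentSpace (𝓡 n).tangent v)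
    (he : IsChart e) (he' : IsChart e') {z : Coord n × Coord n} (hz : z.1 ∈ e.target)
    (hz' : e.symm z.1 ∈ e'.source) :
    fieldCoord X e' (tangentTransition e e' z)
      = fderiv ℝ (tangentTransition e e') z (fieldCoord X e z) := by
  have hv : (ofCoord e z).proj ∈ e.source := e.map_target hz
  have hv' : (ofCoord e z).proj ∈ e'.source := hz'
  have ho : ofCoord e' (tangentTransition e e' z) = ofCoord e z := by
    rw [← tangentCoord_ofCoord_of_isChart he he' hz hz', ofCoord_tangentCoord he' hv']
  have h1 : fieldCoord X e' (tangentTransition e e' z)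
      = mfderiv (𝓡 n).tangent 𝓘(ℝ, Coord n × Coord n) (tangentCoord e') (ofCoord e z)
        (X (ofCoord e z)) := by
    rw [fieldCoord, ho]
  have h2 : tangentCoord e' =ᶠ[𝓝 (ofCoord e z)] tangentTransition e e' ∘ tangentCoord e := by
    filter_upwards [(isOpen_proj_preimage e).mem_nhds hv, (isOpen_proj_preimage e').mem_nhds hv']
      with v h h' using (tangentTransition_tangentCoord he he' h h').symm
  have ht : DifferentiableAt ℝ (tangentTransition e e') (tangentCoord e (ofCoord e z)) := by
    rw [tangentCoord_ofCoord he hz]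
    exact (hasFDerivAt_prodMk_fderiv_apply (contDiffAt_transition he he' hz hz')).differentiableAt
  rw [h1, h2.mfderiv_eq, mfderiv_comp (ofCoord e z) ht.mdifferentiableAt
    ((contMDiffAt_tangentCoord he hv).mdifferentiableAt (by simp)), mfderiv_eq_fderiv,
    tangentCoord_ofCoord he hz]
  rfl

end Charts

/-! ### Divergences, densities and their transformation laws -/

lemma sum_dy_eq_trace {n : ℕ} {c : Coord n × Coord n → Coord n} {z : Coord n × Coord n}
    (hc : DifferentiableAt ℝ c z) :
    ∑ m, dy m (fun w => -(1 / 2) * c w m) z = -(1 / 2) * LinearMap.trace ℝ (Coord n)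
      (fderiv ℝ c z ∘L ContinuousLinearMap.inr ℝ (Coord n) (Coord n) : Coord n →L[ℝ] Coord n) := by
  rw [trace_eq_sum_apply, Finset.mul_sum]
  refine Finset.sum_congr rfl fun m _ => ?_
  have h : HasFDerivAt (fun w => c w m) (EuclideanSpace.proj (𝕜 := ℝ) m ∘L fderiv ℝ c z) z :=
    (EuclideanSpace.proj (𝕜 := ℝ) m).hasFDerivAt.comp z hc.hasFDerivAt
  rw [dy, (h.const_mul (-(1 / 2))).fderiv]
  rfl

lemma sum_mul_fderiv_single {n : ℕ} (f : Coord n → ℝ) (x y : Coord n) :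
    ∑ m, y m * fderiv ℝ f x (EuclideanSpace.single m 1) = fderiv ℝ f x y := by
  have hy : y = ∑ m, y m • EuclideanSpace.single m (1 : ℝ) := by
    ext i
    simp [Pi.single_apply]
  conv_rhs => rw [hy, map_sum]
  simp only [map_smul, smul_eq_mul]

lemma det_comp_comm {n : ℕ} (f g : Coord n →ₗ[ℝ] Coord n) :
    LinearMap.det (f ∘ₗ g) = LinearMap.det (g ∘ₗ f) := by
  rw [LinearMap.det_comp, LinearMap.det_comp, mul_comm]

section Density

variable {n : ℕ} {M : Type*} [TopologicalSpace M] [ChartedSpace (Coord n) M]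
  {e e' : OpenPartialHomeomorph M (Coord n)} {x : Coord n}

lemma fderiv_transition_mul_fderiv_transition (he : IsChart e) (he' : IsChart e')
    (hx : x ∈ e.target) (hx' : e.symm x ∈ e'.source) :
    fderiv ℝ (transition e' e) (transition e e' x) * fderiv ℝ (transition e e') x = 1 := by
  have hinv : e'.symm (transition e e' x) = e.symm x := e'.left_inv hx'
  have h1 : HasFDerivAt (transition e e') (fderiv ℝ (transition e e') x) x :=
    ((contDiffAt_transition he he' hx hx').differentiableAt (by simp)).hasFDerivAt
  have h2 : HasFDerivAt (transition e' e) (fderiv ℝ (transition e' e) (transition e e' x))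
      (transition e e' x) :=
    ((contDiffAt_transition he' he (e'.map_source hx')
      (show e'.symm (transition e e' x) ∈ e.source by
        rw [hinv]; exact e.map_target hx)).differentiableAt (by simp)).hasFDerivAt
  have h3 : transition e' e ∘ transition e e' =ᶠ[𝓝 x] id := by
    filter_upwards [e.symm.isOpen_inter_preimage e'.open_source |>.mem_nhds ⟨hx, hx'⟩] with w hw
    have : e'.symm (e' (e.symm w)) = e.symm w := e'.left_inv hw.2
    simp only [transition, Function.comp_apply, this, id, e.right_inv hw.1]
  exact (h2.comp x h1).unique ((hasFDerivAt_id x).congr_of_eventuallyEq h3)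

lemma VolumeForm.coeff_pos (dV : VolumeForm n M) (he : IsChart e) (hx : x ∈ e.target) :
    0 < dV.coeff e x := by
  refine dV.pos _ _ ?_
  have hli : LinearIndependent ℝ fun i : Fin n => EuclideanSpace.single i (1 : ℝ) := by
    have h := (EuclideanSpace.basisFun (Fin n) ℝ).toBasis.linearIndependent
    rwa [show ⇑(EuclideanSpace.basisFun (Fin n) ℝ).toBasis
      = fun i => EuclideanSpace.single i (1 : ℝ) from funext fun i => by simp] at h
  exact hli.map' (mfderiv (𝓡 n) (𝓡 n) e.symm x).toLinearMap
    ((mdifferentiable_of_isChart he).symm.ker_mfderiv_eq_bot hx)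

/-- The transformation law of the coefficient of a density. -/
lemma VolumeForm.coeff_eq (dV : VolumeForm n M) (he : IsChart e) (he' : IsChart e')
    (hx : x ∈ e.target) (hx' : e.symm x ∈ e'.source) :
    dV.coeff e x = |LinearMap.det (fderiv ℝ (transition e e') x : Coord n →ₗ[ℝ] Coord n)|
      * dV.coeff e' (transition e e' x) := by
  have hinv : e'.symm (transition e e' x) = e.symm x := e'.left_inv hx'
  let A : TangentSpace (𝓡 n) (e.symm x) →ₗ[ℝ] TangentSpace (𝓡 n) (e.symm x) :=
    (mfderiv (𝓡 n) (𝓡 n) e.symm x).toLinearMap ∘ₗ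
      (mfderiv (𝓡 n) (𝓡 n) e' (e.symm x)).toLinearMap
  have hdet : LinearMap.det A
      = LinearMap.det (fderiv ℝ (transition e e') x : Coord n →ₗ[ℝ] Coord n) := by
    -- A is an endomorphism of the tangent space, as `map_det` requires. Swapping its two factors
    -- gives the Jacobian of the transition map, with the same determinant.
    refine (det_comp_comm (mfderiv (𝓡 n) (𝓡 n) e.symm x).toLinearMap
      (mfderiv (𝓡 n) (𝓡 n) e' (e.symm x)).toLinearMap).trans ?_
    refine congrArg _ (LinearMap.ext fun y => ?_)
    exact (fderiv_transition he he' hx hx' y).symm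
  let b : Fin n → TangentSpace (𝓡 n) (e.symm x) := fun i =>
    mfderiv (𝓡 n) (𝓡 n) e'.symm (transition e e' x) (EuclideanSpace.single i (1 : ℝ))
  have h1 : dV.coeff e' (transition e e' x) = dV.density (e.symm x) b := by
    rw [VolumeForm.coeff, hinv]
    rfl
  have h2 : dV.coeff e x = dV.density (e.symm x) (fun i => A (b i)) := by
    refine congrArg _ (funext fun i => ?_)
    exact congrArg (mfderiv (𝓡 n) (𝓡 n) e.symm x)
      (((mdifferentiable_of_isChart he').mfderiv hx').apply_symm_apply
        (EuclideanSpace.single i (1 : ℝ))).symm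
  rw [h1, h2, ← hdet]
  exact dV.map_det _ A b

lemma VolumeForm.contDiffOn_log_coeff (dV : VolumeForm n M) (he : IsChart e) :
    ContDiffOn ℝ ∞ (fun x => Real.log (dV.coeff e x)) e.target :=
  (dV.smooth e he).log fun _ hx => (dV.coeff_pos he hx).ne'

/-- Near x, ln σ is log |det Dφ| plus ln σ' ∘ φ, and Jacobi's formula differentiates the first
summand. Its trace is the one that appears in the fibre divergence. -/
lemma VolumeForm.fderiv_log_coeff (dV : VolumeForm n M) (he : IsChart e) (he' : IsChart e')
    (hx : x ∈ e.target) (hx' : e.symm x ∈ e'.source) (y : Coord n) :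
    fderiv ℝ (fun x => Real.log (dV.coeff e x)) x y
      = LinearMap.trace ℝ (Coord n) (fderiv ℝ (transition e' e) (transition e e' x) *
          fderiv ℝ (fderiv ℝ (transition e e')) x y : Coord n →L[ℝ] Coord n)
        + fderiv ℝ (fun x => Real.log (dV.coeff e' x)) (transition e e' x)
          (fderiv ℝ (transition e e') x y) := by
  have hφ := contDiffAt_transition he he' hx hx'
  have h1 : HasFDerivAt (transition e e') (fderiv ℝ (transition e e') x) x :=
    (hφ.differentiableAt (by simp)).hasFDerivAt
  have h2 : HasFDerivAt (fderiv ℝ (transition e e')) (fderiv ℝ (fderiv ℝ (transition e e')) x) x :=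
    ((hφ.fderiv_right (m := 1) (by norm_cast)).differentiableAt one_ne_zero).hasFDerivAt
  have h3 := hasFDerivAt_log_abs_det h2 (fderiv_transition_mul_fderiv_transition he he' hx hx')
  have h4 : HasFDerivAt (fun x => Real.log (dV.coeff e' x)) _ (transition e e' x) :=
    ((dV.contDiffOn_log_coeff he').differentiableOn (by simp)).differentiableAt
      (e'.open_target.mem_nhds (e'.map_source hx')) |>.hasFDerivAt
  have h5 : (fun x => Real.log (dV.coeff e x)) =ᶠ[𝓝 x] fun w =>
      Real.log |LinearMap.det (fderiv ℝ (transition e e') w : Coord n →ₗ[ℝ] Coord n)|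
        + Real.log (dV.coeff e' (transition e e' w)) := by
    filter_upwards [e.symm.isOpen_inter_preimage e'.open_source |>.mem_nhds ⟨hx, hx'⟩] with w hw
    have hpos := dV.coeff_pos he hw.1
    rw [dV.coeff_eq he he' hw.1 hw.2] at hpos ⊢
    exact Real.log_mul (left_ne_zero_of_mul hpos.ne') (right_ne_zero_of_mul hpos.ne')
  have h6 := (h3.add (h4.comp x h1)).congr_of_eventuallyEq h5
  rw [h6.fderiv]
  rfl

end Density

/-! ### Coordinate independence of the S-curvature -/

section SCurvature

variable {n : ℕ} {M : Type*} [TopologicalSpace M] [ChartedSpace (Coord n) M]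
  [IsManifold (𝓡 n) ∞ M] {e e' : OpenPartialHomeomorph M (Coord n)} {x y : Coord n}

lemma Spray.differentiableAt_fieldCoord_snd (G : Spray n M) (he : IsChart e) (hx : x ∈ e.target)
    (hy : y ≠ 0) : DifferentiableAt ℝ (fun w => (fieldCoord G.field e w).2) (x, y) := by
  rw [differentiableAt_euclidean]
  intro i
  have h : DifferentiableAt ℝ (fieldCoeff G.field e i) (x, y) :=
    ((G.smooth e he i).differentiableOn (by simp)).differentiableAt
      ((e.open_target.prod isOpen_ne).mem_nhds ⟨hx, hy⟩)
  refine (h.const_mul (-2)).congr_of_eventuallyEq (Eventually.of_forall fun w => ?_)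
  simp [fieldCoeff]

/-- The S-curvature does not depend on the coordinates. -/
lemma sCurvatureIn_tangentTransition (G : Spray n M) (dV : VolumeForm n M) (he : IsChart e)
    (he' : IsChart e') (hx : x ∈ e.target) (hx' : e.symm x ∈ e'.source) (hy : y ≠ 0) :
    sCurvatureIn G dV e' (tangentTransition e e' (x, y)) = sCurvatureIn G dV e (x, y) := by
  have hinv : e'.symm (transition e e' x) = e.symm x := e'.left_inv hx'
  have hx2 : transition e e' x ∈ e'.target := e'.map_source hx'
  have hBA := fderiv_transition_mul_fderiv_transition he he' hx hx'
  have hAB := fderiv_transition_mul_fderiv_transition he' he hx2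
    (by rw [hinv]; exact e.map_target hx)
  have hback : transition e' e (transition e e' x) = x := by
    rw [transition, Function.comp_apply, hinv, e.right_inv hx]
  rw [hback] at hAB
  have hφ := contDiffAt_transition he he' hx hx'
  have hsymm : IsSymmSndFDerivAt ℝ (transition e e') x :=
    hφ.isSymmSndFDerivAt (by rw [minSmoothness_of_isRCLikeNormedField]; norm_cast)
  have hy' : fderiv ℝ (transition e e') x y ≠ 0 := by
    intro h0
    apply hy
    have := congrArg (fun L => L y) hBA
    simpa [h0] using! this.symm
  have hc := G.differentiableAt_fieldCoord_snd he hx hy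
  have hc' := G.differentiableAt_fieldCoord_snd he' hx2 hy'
  -- The fibre component of the spray transforms by Dφ plus the quadratic term D²φ(u, u), because
  -- its position component is u itself.
  have htr := trace_fderiv_snd_of_transform hsymm.eq hBA hAB hc hc' fun u => by
    have h1 := fieldCoord_tangentTransition G.field he he' (z := (x, u)) hx hx'
    have h2 := fderiv_prodMk_fderiv_apply (z := (x, u)) hφ (fieldCoord G.field e (x, u))
    have h3 := congrArg Prod.snd (h1.trans h2)
    rw [G.fst_eq e he x hx u] at h3
    exact h3.trans (add_comm _ _)
  have hd := sum_dy_eq_trace hc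
  have hd' := sum_dy_eq_trace hc'
  have hl := dV.fderiv_log_coeff he he' hx hx' y
  have hS : sCurvatureIn G dV e (x, y) = _ - _ :=
    congrArg₂ (· - ·) hd (sum_mul_fderiv_single (fun x => Real.log (dV.coeff e x)) x y)
  have hS' : sCurvatureIn G dV e' (tangentTransition e e' (x, y)) = _ - _ :=
    congrArg₂ (· - ·) hd' (sum_mul_fderiv_single (fun x => Real.log (dV.coeff e' x))
      (transition e e' x) (fderiv ℝ (transition e e') x y))
  rw [hS, hS']
  linear_combination -(1 / 2) * htr + hl

/-- In the coordinates induced by any chart, the S-curvature is given by the local expression. -/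
lemma sCurvature_ofCoord (G : Spray n M) (dV : VolumeForm n M) (he : IsChart e)
    (hx : x ∈ e.target) (hy : y ≠ 0) :
    sCurvature G dV (ofCoord e (x, y)) = sCurvatureIn G dV e (x, y) := by
  have he' : IsChart (chartAt (Coord n) (ofCoord e (x, y)).proj) :=
    IsManifold.chart_mem_maximalAtlas _
  have hx' : e.symm x ∈ (chartAt (Coord n) (ofCoord e (x, y)).proj).source :=
    mem_chart_source (Coord n) (e.symm x)
  rw [sCurvature, tangentCoord_ofCoord_of_isChart he he' hx hx',
    sCurvatureIn_tangentTransition G dV he he' hx hx' hy]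

end SCurvature

/-! ### The projective factor and the Finsler metric |S| -/

section Final

variable {n : ℕ} {M : Type*} [TopologicalSpace M] {e : OpenPartialHomeomorph M (Coord n)}

/-- The coordinates of the nonzero tangent vectors over the domain of a chart. -/
def slitTarget (e : OpenPartialHomeomorph M (Coord n)) : Set (Coord n × Coord n) :=
  e.target ×ˢ {y | y ≠ 0}

lemma isOpen_slitTarget (e : OpenPartialHomeomorph M (Coord n)) : IsOpen (slitTarget e) :=
  e.open_target.prod isOpen_ne

variable [ChartedSpace (Coord n) M]

lemma tangentCoord_mem_slitTarget (he : IsChart e) {v : TangentBundle (𝓡 n) M}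
    (hv : v.proj ∈ e.source) (h0 : v.2 ≠ 0) : tangentCoord e v ∈ slitTarget e :=
  ⟨e.map_source hv, fun h => h0 ((tangentCoord_snd_eq_zero_iff he hv).1 h)⟩

lemma contDiffOn_log_coeff_fst (dV : VolumeForm n M) (he : IsChart e) :
    ContDiffOn ℝ ∞ (fun w : Coord n × Coord n => Real.log (dV.coeff e w.1)) (slitTarget e) :=
  (dV.contDiffOn_log_coeff he).comp contDiffOn_fst fun _ h => h.1

lemma dirDeriv_ydir_log_coeff_fst (dV : VolumeForm n M) (he : IsChart e) (j : Fin n)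
    {z : Coord n × Coord n} (hz : z ∈ slitTarget e) :
    dirDeriv (ydir j) (fun w : Coord n × Coord n => Real.log (dV.coeff e w.1)) z = 0 := by
  have h : HasFDerivAt (fun x => Real.log (dV.coeff e x)) _ z.1 :=
    ((dV.contDiffOn_log_coeff he).differentiableOn (by simp)).differentiableAt
      (e.open_target.mem_nhds hz.1) |>.hasFDerivAt
  have h' : HasFDerivAt (fun w : Coord n × Coord n => Real.log (dV.coeff e w.1)) _ z :=
    h.comp z hasFDerivAt_fst
  rw [dirDeriv, h'.fderiv]
  exact (fderiv ℝ (fun x => Real.log (dV.coeff e x)) z.1).map_zero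

lemma contDiffOn_dlog_coeff (dV : VolumeForm n M) (he : IsChart e) :
    ContDiffOn ℝ ∞ (fun z : Coord n × Coord n => ∑ m, z.2 m *
      dirDeriv (xdir m) (fun w => Real.log (dV.coeff e w.1)) z) (slitTarget e) :=
  ContDiffOn.sum fun m _ => (contDiff_snd_apply m).contDiffOn.mul
    (contDiffOn_dirDeriv (isOpen_slitTarget e) (contDiffOn_log_coeff_fst dV he))

variable [IsManifold (𝓡 n) ∞ M] (G : Spray n M) (dV : VolumeForm n M)

lemma Spray.contDiffOn_coeff (he : IsChart e) (i : Fin n) :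
    ContDiffOn ℝ ∞ (G.coeff e i) (slitTarget e) :=
  G.smooth e he i

lemma Spray.euler_coeff (he : IsChart e) (i : Fin n) {z : Coord n × Coord n}
    (hz : z ∈ slitTarget e) :
    ∑ j, z.2 j * dirDeriv (ydir j) (G.coeff e i) z = 2 * G.coeff e i z := by
  simpa using euler_relation 2
    ((G.contDiffOn_coeff he i).differentiableAt_of_isOpen (isOpen_slitTarget e) hz)
    (G.homogeneous e he i z.1 hz.1 z.2)

/-- The local expression of the S-curvature as a difference of a fibre divergence and a closed
one-form. -/
lemma sCurvatureIn_eq (he : IsChart e) {z : Coord n × Coord n} (hz : z.1 ∈ e.target) :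
    sCurvatureIn G dV e z = ∑ m, dirDeriv (ydir m) (G.coeff e m) z
      - ∑ m, z.2 m * dirDeriv (xdir m) (fun w => Real.log (dV.coeff e w.1)) z := by
  have h : HasFDerivAt (fun x => Real.log (dV.coeff e x)) _ z.1 :=
    ((dV.contDiffOn_log_coeff he).differentiableOn (by simp)).differentiableAt
      (e.open_target.mem_nhds hz) |>.hasFDerivAt
  have h' : HasFDerivAt (fun w : Coord n × Coord n => Real.log (dV.coeff e w.1)) _ z :=
    h.comp z hasFDerivAt_fst
  simp only [sCurvatureIn, dirDeriv, h'.fderiv]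
  rfl

lemma contDiffOn_divergence (he : IsChart e) :
    ContDiffOn ℝ ∞ (fun z => ∑ m, dirDeriv (ydir m) (G.coeff e m) z) (slitTarget e) :=
  ContDiffOn.sum fun m _ => contDiffOn_dirDeriv (isOpen_slitTarget e) (G.contDiffOn_coeff he m)

lemma contDiffOn_sCurvatureIn (he : IsChart e) :
    ContDiffOn ℝ ∞ (sCurvatureIn G dV e) (slitTarget e) :=
  ((contDiffOn_divergence G he).sub (contDiffOn_dlog_coeff dV he)).congr
    fun _ hz => sCurvatureIn_eq G dV he hz.1

/-- If the χ-curvature vanishes, then so does the Euler-Lagrange expression of the S-curvature. -/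
lemma eulerLagrange_sCurvatureIn (hG : G.ChiVanishes) (he : IsChart e) {z : Coord n × Coord n}
    (hz : z ∈ slitTarget e) (k : Fin n) :
    eulerLagrange (G.coeff e) (sCurvatureIn G dV e) k z = 0 := by
  have hU := isOpen_slitTarget e
  have h1 : sCurvatureIn G dV e =ᶠ[𝓝 z] fun z => ∑ m, dirDeriv (ydir m) (G.coeff e m) z
      - ∑ m, z.2 m * dirDeriv (xdir m) (fun w => Real.log (dV.coeff e w.1)) z := by
    filter_upwards [hU.mem_nhds hz] with w hw using sCurvatureIn_eq G dV he hw.1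
  have h2 := chi_eq_eulerLagrange hU (G.contDiffOn_coeff he) (fun i _ h => G.euler_coeff he i h) k hz
  rw [show chi (G.coeff e) k z = 0 from hG e he z.1 hz.1 z.2 hz.2 k] at h2
  rw [eulerLagrange_congr h1, eulerLagrange_sub hU (contDiffOn_divergence G he)
    (contDiffOn_dlog_coeff dV he) hz, eulerLagrange_sum_snd_mul_dx hU
    (contDiffOn_log_coeff_fst dV he) (fun j _ h => dirDeriv_ydir_log_coeff_fst dV he j h) hz]
  linarith

/-- The function `|S|` in the coordinates induced by a chart. -/
def absSIn (e : OpenPartialHomeomorph M (Coord n)) (w : Coord n × Coord n) : ℝ :=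
  |sCurvature G dV (ofCoord e w)|

/-- The derivative of a function on `TM` along a vector field on `TM`. -/
def fieldDeriv (X : ∀ v : TangentBundle (𝓡 n) M, TangentSpace (𝓡 n).tangent v)
    (f : TangentBundle (𝓡 n) M → ℝ) (v : TangentBundle (𝓡 n) M) : ℝ :=
  mfderiv (𝓡 n).tangent 𝓘(ℝ, ℝ) f v (X v)

lemma fieldCoord_tangentCoord (X : ∀ v : TangentBundle (𝓡 n) M, TangentSpace (𝓡 n).tangent v)
    (he : IsChart e) {v : TangentBundle (𝓡 n) M} (hv : v.proj ∈ e.source) :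
    fieldCoord X e (tangentCoord e v)
      = mfderiv (𝓡 n).tangent 𝓘(ℝ, Coord n × Coord n) (tangentCoord e) v (X v) := by
  rw [fieldCoord, ofCoord_tangentCoord he hv]

/-- By the chain rule, the intrinsic derivative along X can be computed in any chart containing the
base point. -/
lemma fieldDeriv_eq_fderiv (X : ∀ v : TangentBundle (𝓡 n) M, TangentSpace (𝓡 n).tangent v)
    (f : TangentBundle (𝓡 n) M → ℝ) (he : IsChart e) {v : TangentBundle (𝓡 n) M}
    (hv : v.proj ∈ e.source)
    (hd : DifferentiableAt ℝ (fun w => f (ofCoord e w)) (tangentCoord e v)) :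
    fieldDeriv X f v = fderiv ℝ (fun w => f (ofCoord e w)) (tangentCoord e v)
      (fieldCoord X e (tangentCoord e v)) := by
  have h1 : f =ᶠ[𝓝 v] (fun w => f (ofCoord e w)) ∘ tangentCoord e := by
    filter_upwards [(isOpen_proj_preimage e).mem_nhds hv] with w hw
    rw [Function.comp_apply, ofCoord_tangentCoord he hw]
  have h2 : mfderiv (𝓡 n).tangent 𝓘(ℝ, ℝ) f v
      = mfderiv (𝓡 n).tangent 𝓘(ℝ, ℝ) ((fun w => f (ofCoord e w)) ∘ tangentCoord e) v :=
    h1.mfderiv_eq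
  have h3 := mfderiv_comp v hd.mdifferentiableAt
      ((contMDiffAt_tangentCoord he hv).mdifferentiableAt (by simp))
  rw [fieldDeriv, fieldCoord_tangentCoord X he hv, ← mfderiv_eq_fderiv]
  exact congrArg (fun L => L (X v)) (h2.trans h3)

lemma fderiv_fieldCoord (he : IsChart e) (f : Coord n × Coord n → ℝ) {z : Coord n × Coord n}
    (hz : z.1 ∈ e.target) :
    fderiv ℝ f z (fieldCoord G.field e z) = sprayDeriv (G.coeff e) f z := by
  have h4 : fieldCoord G.field e z = (z.2, 0) + (0, (fieldCoord G.field e z).2) := by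
    refine Prod.ext ?_ (zero_add _).symm
    exact (G.fst_eq e he _ hz z.2).trans (add_zero _).symm
  rw [h4, map_add, ← sum_mul_dirDeriv_xdir, ← sum_snd_mul_dirDeriv_ydir, sprayDeriv,
    Finset.mul_sum, sub_eq_add_neg, ← Finset.sum_neg_distrib]
  congr 1
  refine Finset.sum_congr rfl fun j _ => ?_
  rw [Spray.coeff, fieldCoeff]
  ring

/-- The projective factor: half the logarithmic derivative of `|S|` along the spray. -/
def projectiveFactor (v : TangentBundle (𝓡 n) M) : ℝ :=
  fieldDeriv G.field (fun v => |sCurvature G dV v|) v / (2 * |sCurvature G dV v|)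

variable {G dV}

lemma absSIn_ne_zero (hF : IsFinslerMetric fun v => |sCurvature G dV v|)
    (he : IsChart e) {z : Coord n × Coord n} (hz : z ∈ slitTarget e) :
    absSIn G dV e z ≠ 0 := fun h =>
  hz.2 ((ofCoord_snd_eq_zero_iff he hz.1).1 ((hF.eq_zero_iff _).1 h))

/-- S is continuous and nonzero at nonzero vectors, so its sign is locally constant. No global
choice of sign is needed: smoothness and the Euler-Lagrange equation are local. -/
lemma absSIn_eventuallyEq (hF : IsFinslerMetric fun v => |sCurvature G dV v|)
    (he : IsChart e) {z : Coord n × Coord n} (hz : z ∈ slitTarget e) :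
    absSIn G dV e =ᶠ[𝓝 z] sCurvatureIn G dV e ∨
      absSIn G dV e =ᶠ[𝓝 z] fun w => -sCurvatureIn G dV e w := by
  have hU := (isOpen_slitTarget e).mem_nhds hz
  have hS : ∀ w ∈ slitTarget e, absSIn G dV e w = |sCurvatureIn G dV e w| := fun w hw => by
    rw [absSIn, sCurvature_ofCoord G dV he hw.1 hw.2]
  have hc : ContinuousAt (sCurvatureIn G dV e) z :=
    (contDiffOn_sCurvatureIn G dV he).continuousOn.continuousAt hU
  have h0 : sCurvatureIn G dV e z ≠ 0 := by
    rw [← abs_ne_zero, ← hS z hz]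
    exact absSIn_ne_zero hF he hz
  rcases h0.lt_or_gt with h | h
  · right
    filter_upwards [hU, hc.eventually_lt_const h] with w hw hneg
    rw [hS w hw, abs_of_neg hneg]
  · left
    filter_upwards [hU, hc.eventually_const_lt h] with w hw hpos
    rw [hS w hw, abs_of_pos hpos]

lemma contDiffOn_absSIn (hF : IsFinslerMetric fun v => |sCurvature G dV v|)
    (he : IsChart e) : ContDiffOn ℝ ∞ (absSIn G dV e) (slitTarget e) := by
  intro z hz
  have hS := (contDiffOn_sCurvatureIn G dV he).contDiffAt ((isOpen_slitTarget e).mem_nhds hz)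
  rcases absSIn_eventuallyEq hF he hz with h | h
  · exact (hS.congr_of_eventuallyEq h).contDiffWithinAt
  · exact (hS.neg.congr_of_eventuallyEq h).contDiffWithinAt

lemma eulerLagrange_absSIn (hF : IsFinslerMetric fun v => |sCurvature G dV v|)
    (hG : G.ChiVanishes) (he : IsChart e) {z : Coord n × Coord n}
    (hz : z ∈ slitTarget e) (k : Fin n) :
    eulerLagrange (G.coeff e) (absSIn G dV e) k z = 0 := by
  rcases absSIn_eventuallyEq hF he hz with h | h
  · rw [eulerLagrange_congr h, eulerLagrange_sCurvatureIn G dV hG he hz]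
  · rw [eulerLagrange_congr h, eulerLagrange_neg, eulerLagrange_sCurvatureIn G dV hG he hz, neg_zero]

lemma absSIn_smul (hF : IsFinslerMetric fun v => |sCurvature G dV v|)
    (he : IsChart e) {z : Coord n × Coord n} (hz : z ∈ slitTarget e) {c : ℝ}
    (hc : 0 < c) : absSIn G dV e (z.1, c • z.2) = c * absSIn G dV e z := by
  have h0 : (ofCoord e z).2 ≠ 0 := fun h => hz.2 ((ofCoord_snd_eq_zero_iff he hz.1).1 h)
  have h := hF.homogeneous (e.symm z.1) (ofCoord e z).2 h0 c hc
  have hs : ofCoord e (z.1, c • z.2) = ⟨e.symm z.1, c • (ofCoord e z).2⟩ :=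
    congrArg _ ((mfderiv (𝓡 n) (𝓡 n) e.symm z.1).map_smul c z.2)
  rw [absSIn, hs]
  exact h

lemma euler_absSIn (hF : IsFinslerMetric fun v => |sCurvature G dV v|)
    (he : IsChart e) {z : Coord n × Coord n} (hz : z ∈ slitTarget e) :
    ∑ j, z.2 j * dirDeriv (ydir j) (absSIn G dV e) z = absSIn G dV e z := by
  simpa using euler_relation 1
    ((contDiffOn_absSIn hF he).differentiableAt_of_isOpen (isOpen_slitTarget e) hz)
    (fun c hc => by simpa using absSIn_smul hF he hz hc)

/-- Identifies the intrinsic factor with the P of Rapcsák's criterion in every chart, so the local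
factors agree on overlaps. -/
lemma projectiveFactor_eq (hF : IsFinslerMetric fun v => |sCurvature G dV v|)
    (he : IsChart e) {v : TangentBundle (𝓡 n) M} (hv : v.proj ∈ e.source)
    (h0 : v.2 ≠ 0) :
    projectiveFactor G dV v = sprayDeriv (G.coeff e) (absSIn G dV e) (tangentCoord e v)
      / (2 * absSIn G dV e (tangentCoord e v)) := by
  have hz := tangentCoord_mem_slitTarget he hv h0
  have hd := (contDiffOn_absSIn hF he).differentiableAt_of_isOpen (isOpen_slitTarget e) hz
  have h1 : fieldDeriv G.field (fun v => |sCurvature G dV v|) v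
      = fderiv ℝ (absSIn G dV e) (tangentCoord e v) (fieldCoord G.field e (tangentCoord e v)) :=
    fieldDeriv_eq_fderiv G.field (fun v => |sCurvature G dV v|) he hv hd
  rw [projectiveFactor, h1, fderiv_fieldCoord G he _ hz.1, absSIn, ofCoord_tangentCoord he hv]

lemma contMDiffOn_projectiveFactor (hF : IsFinslerMetric fun v => |sCurvature G dV v|) :
    ContMDiffOn (𝓡 n).tangent 𝓘(ℝ, ℝ) ∞ (projectiveFactor G dV) (slit n M) := by
  intro v h0
  refine ContMDiffAt.contMDiffWithinAt ?_
  let e := chartAt (Coord n) v.proj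
  have he : IsChart e := IsManifold.chart_mem_maximalAtlas v.proj
  have hv : v.proj ∈ e.source := mem_chart_source (Coord n) v.proj
  have hU := isOpen_slitTarget e
  have hz := hU.mem_nhds (tangentCoord_mem_slitTarget he hv h0)
  have ht := contMDiffAt_tangentCoord he hv
  have hF1 := contDiffOn_absSIn hF he
  have hs : ContDiffOn ℝ ∞ (sprayDeriv (G.coeff e) (absSIn G dV e)) (slitTarget e) :=
    (ContDiffOn.sum fun j _ => (contDiff_snd_apply j).contDiffOn.mul
      (contDiffOn_dirDeriv hU hF1)).sub (contDiffOn_const.mul (ContDiffOn.sum fun j _ =>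
        (G.contDiffOn_coeff he j).mul (contDiffOn_dirDeriv hU hF1)))
  have hq : ContDiffOn ℝ ∞ (fun z => sprayDeriv (G.coeff e) (absSIn G dV e) z
      / (2 * absSIn G dV e z)) (slitTarget e) :=
    hs.div (contDiffOn_const.mul hF1) fun z hz => mul_ne_zero two_ne_zero (absSIn_ne_zero hF he hz)
  refine ((hq.contDiffAt hz).contMDiffAt.comp v ht).congr_of_eventuallyEq ?_
  filter_upwards [(isOpen_proj_preimage e).mem_nhds hv, ht.continuousAt.preimage_mem_nhds hz]
    with w hw hw'
  exact projectiveFactor_eq hF he hw fun h => hw'.2 ((tangentCoord_snd_eq_zero_iff he hw).2 h)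

lemma posHomogeneous_projectiveFactor (hF : IsFinslerMetric fun v => |sCurvature G dV v|) :
    PosHomogeneous (projectiveFactor G dV) := by
  intro p v h0 c hc
  let e := chartAt (Coord n) p
  have he : IsChart e := IsManifold.chart_mem_maximalAtlas p
  have hp : p ∈ e.source := mem_chart_source (Coord n) p
  have hU := isOpen_slitTarget e
  have hz := tangentCoord_mem_slitTarget (v := ⟨p, v⟩) he hp h0
  have hcz := tangentCoord_mem_slitTarget (v := ⟨p, c • v⟩) he hp (smul_ne_zero hc.ne' h0)
  have ht : tangentCoord e (⟨p, c • v⟩ : TangentBundle (𝓡 n) M)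
      = ((tangentCoord e ⟨p, v⟩).1, c • (tangentCoord e ⟨p, v⟩).2) :=
    Prod.ext rfl ((mfderiv (𝓡 n) (𝓡 n) e p).map_smul c v)
  rw [projectiveFactor_eq hF he (v := ⟨p, c • v⟩) hp (smul_ne_zero hc.ne' h0),
    projectiveFactor_eq hF he (v := ⟨p, v⟩) hp h0]
  rw [ht] at hcz ⊢
  rw [sprayDeriv_smul hc, absSIn_smul hF he hz hc]
  · have := absSIn_ne_zero hF he hz
    have := hc.ne'
    field_simp
  · filter_upwards [hU.mem_nhds hz] with w hw using absSIn_smul hF he hw hc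
  · exact (contDiffOn_absSIn hF he).differentiableAt_of_isOpen hU hcz
  · exact fun i => G.homogeneous e he i _ hz.1 _ c hc

end Final

end SprayGeometry

end

theorem theorem4p3 {n : ℕ} {M : Type*} [TopologicalSpace M]
    [ChartedSpace (SprayGeometry.Coord n) M] [IsManifold (𝓡 n) ∞ M]
    (G : SprayGeometry.Spray n M) (hG : G.ChiVanishes) (dV : SprayGeometry.VolumeForm n M)
    (hF : SprayGeometry.IsFinslerMetric (fun v => |SprayGeometry.sCurvature G dV v|)) :
    SprayGeometry.ProjectivelyEquivalent (fun v => |SprayGeometry.sCurvature G dV v|) G := by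
  open SprayGeometry in
  refine ⟨projectiveFactor G dV, contMDiffOn_projectiveFactor hF,
    posHomogeneous_projectiveFactor hF, fun e he x hx y hy i => ?_⟩
  have hz : (x, y) ∈ slitTarget e := ⟨hx, hy⟩
  have h0 : (ofCoord e (x, y)).2 ≠ 0 := fun h => hy ((ofCoord_snd_eq_zero_iff he hx).1 h)
  rw [projectiveFactor_eq hF he (e.map_target hx) h0, tangentCoord_ofCoord he hx]
  exact finslerCoeff_eq_of_eulerLagrange_eq_zero (isOpen_slitTarget e) (contDiffOn_absSIn hF he)
    (fun w hw => euler_absSIn hF he hw) hz (absSIn_ne_zero hF he hz)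
    (eulerLagrange_absSIn hF hG he hz) (hF.posDef e he x hx y hy) i
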